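/- Let $p$ be a prime, $r\in\{1,\dots,p-1\}$, $\varepsilon\in[0,1]$ and $\mu\le 1-\frac rp$. A Max-LinSAT instance consists of a matrix $B\in\mathbb F_p^{m\times n}$ with $m>n\ge 1$ and rows $\mathbf b_1,\dots,\mathbf b_m$, and sets $F_1,\dots,F_m\subseteq\mathbb F_p$, here all with $|F_i|=r$; $\mathbf x\in\mathbb F_p^n$ satisfies the $i$-th constraint if $\mathbf b_i\cdot\mathbf x\in F_i$. Let $f_i$ be $1$ on $F_i$ and $-1$ off $F_i$, $f(\mathbf x)=\sum_i f_i(\mathbf b_i\cdot\mathbf x)$, $\bar f_i=\frac1p\sum_y f_i(y)$, $g_i=(f_i-\bar f_i)/\big(\sum_y|f_i(y)-\bar f_i|^2\big)^{1/2}$, and $$|P^{(k)}\rangle=\frac1{\sqrt{p^{n-k}\binom mk}}\sum_{\mathbf x\in\mathbb F_p^n}\ \sum_{S\subseteq[m],\,|S|=k}\ \prod_{i\in S}g_i(\mathbf b_i\cdot\mathbf x)\,|\mathbf x\rangle .$$ For a polynomial $P$ of degree at most $l$ such that $|P(f)\rangle=\sum_{\mathbf x}P(f(\mathbf x))|\mathbf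 x\rangle$ equals $\sum_{k=0}^l w_k|P^{(k)}\rangle$ with a unit vector $\mathbf w\in\mathbb C^{l+1}$, let $\langle s_D^{(m,l)}\rangle$ be the expected number of satisfied constraints when $\mathcal E^{\otimes n}(|P(f)\rangle\langle P(f)|)$ is measured in the computational basis, where $\mathcal E(\rho)=(1-\varepsilon)\rho+\varepsilon\operatorname{Tr}(\rho)I/p$. Let $\langle s_D^{(m,l)}\rangle_{\mathrm{opt}}$ be its supremum over all such $P$, and put $\tau_1(B,\varepsilon)=\frac1m\sum_{i=1}^m(1-\varepsilon)^{|\mathbf b_i|}$, where $|\mathbf b_i|$ is the number of nonzero entries of $\mathbf b_i$, and $$\beta=\mu-2\mu\frac rp+2\sqrt{\frac rp\Big(1-\frac rp\Big)}\sqrt{\mu(1-\mu)} .$$ Consider a sequence of such instances with numbers $l$ such that $m,l\to\infty$, $l/m=\mu$ for every member of the sequence, and $2l+1<d^\perp$, where $d^\perp$ is the minimum distance of the code $\{\mathbf v\in\mathbb F_p^m: B^T\mathbf v=\mathbf 0\}$; $n$, $B$ and the $F_i$ may vary along the sequence. 1. For each instance, let $A^{(m,l,d)}$ be the symmetric tridiagonal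 $(l+1)\times(l+1)$ matrix with diagonal $0,d,2d,\dots,ld$, $d=\frac{p-2r}{\sqrt{r(p-r)}}$, and off-diagonal entries $a_k=\sqrt{k(m-k+1)}$, $k=1,\dots,l$. Unit eigenvectors $\mathbf w$ for its largest eigenvalue exist; each of them is the coefficient vector of a polynomial $P$ of degree at most $l$ as above, and attains $\langle s_D^{(m,l)}\rangle_{\mathrm{opt}}$. 2. $\displaystyle \frac{\langle s_D^{(m,l)}\rangle_{\mathrm{opt}}}{m}-\Big(\frac rp+\tau_1(B,\varepsilon)\,\beta\Big)\longrightarrow 0 .$ In particular, if $\tau_1(B,\varepsilon)\to\tau$ along the sequence (for instance if it is constant, equal to $\tau$), then $$\lim_{\substack{m,l\to\infty\\ l/m=\mu}}\frac{\langle s_D^{(m,l)}\rangle_{\mathrm{opt}}}{m}=\frac rp+\tau\,\beta .$$ 3. If $L_1\le|\mathbf b_i|\le L_2$ for all rows of all the matrices $B$ in the sequence, then the lower and upper limits of $\frac1m\langle s_D^{(m,l)}\rangle_{\mathrm{opt}}-\frac rp$ lie between $(1-\varepsilon)^{L_2}\beta$ and $(1-\varepsilon)^{L_1}\beta$, and so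 does its limit whenever the limit exists. -/

import Mathlib

open Filter Topology Polynomial

noncomputable section

namespace NoisyDQI

/-- A `Max-LinSAT` instance over `𝔽_p` with `m` constraints `(B x)_i ∈ F_i` in `n` unknowns. -/
structure MaxLinSAT (p m n : ℕ) where
  B : Matrix (Fin m) (Fin n) (ZMod p)
  F : Fin m → Finset (ZMod p)

/-- The matrix element `⟨x| Φ^{⊗n}(ρ) |y⟩` of the `n`-fold tensor power of a linear map `Φ` on
`q × q` matrices: expand `ρ = ∑ ρ_{a b} ⨂_j |a_j⟩⟨b_j|` and apply `Φ` to every tensor factor. -/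
def tensorPower {κ : Type*} [Fintype κ] [DecidableEq κ] (n : ℕ)
    (Φ : Matrix κ κ ℂ →ₗ[ℂ] Matrix κ κ ℂ) (ρ : Matrix (Fin n → κ) (Fin n → κ) ℂ) :
    Matrix (Fin n → κ) (Fin n → κ) ℂ :=
  fun x y => ∑ a : Fin n → κ, ∑ b : Fin n → κ,
    ρ a b * ∏ j, Φ (Matrix.single (a j) (b j) 1) (x j) (y j)

/-- The depolarizing channel `ρ ↦ (1 - ε) ρ + ε Tr(ρ) I / p` on one qudit of dimension `p`. -/
def depolarizing (p : ℕ) [NeZero p] (ε : ℝ) :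
    Matrix (ZMod p) (ZMod p) ℂ →ₗ[ℂ] Matrix (ZMod p) (ZMod p) ℂ :=
  (1 - (ε : ℂ)) • LinearMap.id
    + ((ε : ℂ) / (p : ℂ)) • (Matrix.traceLinearMap (ZMod p) ℂ ℂ).smulRight 1

/-- The density matrix `|ψ⟩⟨ψ|`. -/
def density {κ : Type*} (ψ : κ → ℂ) : Matrix κ κ ℂ :=
  Matrix.vecMulVec ψ (star ψ)

/-- The minimum (Hamming) distance of a code; it is `⊤` when the code has at most one word. -/
def minDistance {ι K : Type*} [Fintype ι] [DecidableEq K] (C : Set (ι → K)) : ℕ∞ :=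
  ⨅ (u ∈ C) (v ∈ C) (_ : u ≠ v), (hammingDist u v : ℕ∞)

/-- The code `C^⊥ = {v : Bᵀ v = 0}`. -/
def dualCode {p m n : ℕ} (B : Matrix (Fin m) (Fin n) (ZMod p)) : Set (Fin m → ZMod p) :=
  {v | B.transpose.mulVec v = 0}

/-- `τ₁(B, ε)`: the average over the rows `b_i` of `B` of `(1 - ε) ^ |b_i|`, where `|b_i|` is the
number of nonzero entries of `b_i`. -/
def tau1 {p m n : ℕ} (B : Matrix (Fin m) (Fin n) (ZMod p)) (ε : ℝ) : ℝ :=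
  (∑ i, (1 - ε) ^ hammingNorm (B i)) / m

/-- The symmetric tridiagonal `(l+1) × (l+1)` matrix `A^{(m,l,d)}` with diagonal entries
`0, d, 2d, …, l d` and off-diagonal entries `a_k = √(k (m - k + 1))`, `k = 1, …, l`, the entry `a_k`
standing in the positions `(k-1, k)` and `(k, k-1)` (indices starting at `0`). -/
def tridiagonal (m l : ℕ) (d : ℝ) : Matrix (Fin (l + 1)) (Fin (l + 1)) ℝ :=
  fun i j =>
    if i = j then (i : ℝ) * d
    else if (i : ℕ) + 1 = (j : ℕ) then Real.sqrt ((j : ℝ) * ((m : ℝ) - (j : ℝ) + 1))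
    else if (j : ℕ) + 1 = (i : ℕ) then Real.sqrt ((i : ℝ) * ((m : ℝ) - (i : ℝ) + 1))
    else 0

/-- `w` is a normalized principal eigenvector of the real square matrix `A`: a unit vector that is
an eigenvector for the largest eigenvalue of `A`. -/
def IsPrincipalEigenvector {l : ℕ} (A : Matrix (Fin l) (Fin l) ℝ)
    (w : EuclideanSpace ℂ (Fin l)) : Prop :=
  ‖w‖ = 1 ∧ ∃ lam : ℝ, IsGreatest {x : ℝ | Module.End.HasEigenvalue (Matrix.toLin' A) x} lam ∧
    ∀ i, ∑ j, (A i j : ℂ) * w j = (lam : ℂ) * w i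

namespace MaxLinSAT

variable {p m n : ℕ} (I : MaxLinSAT p m n)

/-- The `±1`-valued indicator function `f_i` of `F_i`. -/
def f (i : Fin m) (y : ZMod p) : ℝ := if y ∈ I.F i then 1 else -1

/-- The objective function `f(x) = ∑ i, f_i (b_i · x)`. -/
def objective (x : Fin n → ZMod p) : ℝ := ∑ i, I.f i (I.B.mulVec x i)

/-- The number of constraints that `x` satisfies. -/
def satisfied (x : Fin n → ZMod p) : ℕ :=
  (Finset.univ.filter fun i => I.B.mulVec x i ∈ I.F i).card

/-- The state `|P(f)⟩ = ∑ x, P(f(x)) |x⟩` of a polynomial `P`, in the computational basis. -/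
def polyState (P : ℂ[X]) : (Fin n → ZMod p) → ℂ :=
  fun x => P.eval (I.objective x : ℂ)

variable [NeZero p]

/-- The mean value of `f_i`. -/
def fMean (i : Fin m) : ℝ := (∑ y, I.f i y) / p

/-- The normalization `φ` of `f_i` minus its mean value. -/
def phi (i : Fin m) : ℝ := Real.sqrt (∑ y, |I.f i y - I.fMean i| ^ 2)

/-- The centred and normalized function `g_i`. -/
def g (i : Fin m) (y : ZMod p) : ℝ := (I.f i y - I.fMean i) / I.phi i

/-- `P^{(k)}(g_1(b_1 · x), …, g_m(b_m · x))`: the sum over the `k`-element sets `{i_1, …, i_k}` of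
constraints of the products of the `g_i(b_i · x)`. -/
def elemSym (k : ℕ) (x : Fin n → ZMod p) : ℝ :=
  ∑ S ∈ (Finset.univ : Finset (Fin m)).powersetCard k, ∏ i ∈ S, I.g i (I.B.mulVec x i)

/-- The state `|P^{(k)}⟩`, in the computational basis. -/
def basisState (k : ℕ) : (Fin n → ZMod p) → ℂ :=
  fun x => ((1 / Real.sqrt ((p : ℝ) ^ ((n : ℤ) - (k : ℤ)) * (m.choose k : ℝ)) * I.elemSym k x : ℝ) : ℂ)

/-- The DQI state `∑ k ≤ l, w_k |P^{(k)}⟩`. -/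
def dqiState {l : ℕ} (w : EuclideanSpace ℂ (Fin (l + 1))) : (Fin n → ZMod p) → ℂ :=
  fun x => ∑ k : Fin (l + 1), w k * I.basisState k x

/-- The expected number of satisfied constraints when the noisy state `ℰ^{⊗n}(|ψ⟩⟨ψ|)`, with `ℰ` the
depolarizing channel of strength `ε`, is measured in the computational basis: the outcome `x` has
probability `⟨x| ℰ^{⊗n}(|ψ⟩⟨ψ|) |x⟩`. -/
def expectedSatisfied (ε : ℝ) (ψ : (Fin n → ZMod p) → ℂ) : ℝ :=
  ∑ x, (tensorPower n (depolarizing p ε) (density ψ) x x).re * (I.satisfied x : ℝ)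

/-- The values of `⟨s_D^{(m,l)}⟩` over all degree-`l` polynomials `P` (the coefficient of degree `l`
may vanish) for which `|P(f)⟩ = ∑ k ≤ l, w_k |P^{(k)}⟩` with a unit vector `w`. -/
def achievable (l : ℕ) (ε : ℝ) : Set ℝ :=
  {s | ∃ (P : ℂ[X]) (w : EuclideanSpace ℂ (Fin (l + 1))), P.natDegree ≤ l ∧ ‖w‖ = 1 ∧
    I.polyState P = I.dqiState w ∧ s = I.expectedSatisfied ε (I.polyState P)}

/-- The optimal value `⟨s_D^{(m,l)}⟩_opt`. -/
def optSatisfied (l : ℕ) (ε : ℝ) : ℝ := sSup (I.achievable l ε)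

end MaxLinSAT

/-- The bracket `μ - 2 μ q + 2 √(q (1 - q)) √(μ (1 - μ))`, where `q = r / p`. -/
def bracket (q μ : ℝ) : ℝ :=
  μ - 2 * μ * q + 2 * Real.sqrt (q * (1 - q)) * Real.sqrt (μ * (1 - μ))

end NoisyDQI

end

/-!
Measurement after depolarizing noise is a classical channel that resamples each coordinate with
probability `ε`, so it damps the standardized indicator `v_i` of the `i`-th constraint by exactly
`(1 - ε) ^ |b_i|`. Any `2 l + 1` rows of `B` are linearly independent, since a dependency is a word
of the dual code, so the values `b_i · x` behave as independent uniform variables in every moment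
that occurs below: the normalized elementary symmetric functions of the `v_i` are orthonormal, and
multiplication by a single `v_i` acts on their span as `A^{(m,l,d)} / m`, where `d` is the skewness
of `v_i`. Hence the expected number of satisfied constraints is
`m q + √(q (1 - q)) τ₁(B, ε) w† A w` with `q = r / p`, and the optimum is governed by the largest
eigenvalue of `A`.

Gershgorin's theorem bounds this eigenvalue from above by essentially `m` times the maximum of
`x d + 2 √(x (1 - x))` over `x ≤ l / m`. The maximum is attained at `x = l / m` because `l / m` is
at most `1 - q`, and the indicator function of the last `√l` coordinates has asymptotically this
Rayleigh quotient.
-/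

namespace NoisyDQI

open Finset Matrix
open scoped BigOperators

section Noise

variable {κ : Type*} [Fintype κ] [DecidableEq κ]

/-- The transition probability from `a` to `x` of the classical channel that depolarizing noise of
strength `ε` induces on measurement outcomes: `a` is kept with probability `1 - ε`, and replaced by
a uniformly random element otherwise. -/
noncomputable def depolarizingKernel (ε : ℝ) (a x : κ) : ℝ :=
  (1 - ε) * (if a = x then 1 else 0) + ε / Fintype.card κ

theorem sum_depolarizingKernel_mul (ε : ℝ) (a : κ) (h : κ → ℝ) :
    ∑ x, depolarizingKernel ε a x * h x = (1 - ε) * h a + ε * 𝔼 x, h x := by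
  simp only [depolarizingKernel, add_mul, sum_add_distrib, mul_assoc, ← mul_sum, ite_mul, one_mul,
    zero_mul, sum_ite_eq, mem_univ, if_true, Fintype.expect_eq_sum_div_card]
  ring

theorem sum_depolarizingKernel [Nonempty κ] (ε : ℝ) (a : κ) :
    ∑ x, depolarizingKernel ε a x = 1 := by
  simpa using sum_depolarizingKernel_mul ε a fun _ => 1

theorem tensorPower_apply_self {Φ : Matrix κ κ ℂ →ₗ[ℂ] Matrix κ κ ℂ} {K : κ → κ → ℂ}
    (hΦ : ∀ a b x, Φ (single a b 1) x x = if a = b then K a x else 0) {n : ℕ}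
    (ρ : Matrix (Fin n → κ) (Fin n → κ) ℂ) (x : Fin n → κ) :
    tensorPower n Φ ρ x x = ∑ a, ρ a a * ∏ j, K (a j) (x j) := by
  refine sum_congr rfl fun a _ => ?_
  rw [sum_eq_single a _ (by simp)]
  · simp [hΦ]
  · intro b _ hba
    obtain ⟨j, hj⟩ := Function.ne_iff.mp hba
    rw [prod_eq_zero (mem_univ j) (by rw [hΦ, if_neg hj.symm]), mul_zero]

theorem depolarizing_single_apply_self {p : ℕ} [NeZero p] (ε : ℝ) (a b x : ZMod p) :
    depolarizing p ε (single a b 1) x x = if a = b then (depolarizingKernel ε a x : ℂ) else 0 := by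
  by_cases hab : a = b
  · subst hab
    by_cases hx : a = x <;> simp [depolarizing, depolarizingKernel, hx, ZMod.card]
  · have : ¬ (a = x ∧ b = x) := fun h => hab (h.1.trans h.2.symm)
    simp [depolarizing, hab, this]

omit [Fintype κ] [DecidableEq κ] in
theorem re_density_apply_self (ψ : κ → ℂ) (a : κ) :
    (density ψ a a).re = Complex.normSq (ψ a) := by
  simp [density, vecMulVec_apply, Complex.normSq_apply]

theorem expectedSatisfied_eq_sum {p m n : ℕ} [NeZero p] (I : MaxLinSAT p m n) (ε : ℝ)
    (ψ : (Fin n → ZMod p) → ℂ) :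
    I.expectedSatisfied ε ψ = ∑ a, Complex.normSq (ψ a) *
      ∑ x : Fin n → ZMod p, (∏ j, depolarizingKernel ε (a j) (x j)) * I.satisfied x := by
  simp only [MaxLinSAT.expectedSatisfied, tensorPower_apply_self (depolarizing_single_apply_self ε),
    ← Complex.ofReal_prod, Complex.re_sum, Complex.re_mul_ofReal, re_density_apply_self, sum_mul,
    mul_sum, mul_assoc]
  exact sum_comm

theorem sum_prod_depolarizingKernel [Nonempty κ] (ε : ℝ) {n : ℕ} (a : Fin n → κ) :
    ∑ x : Fin n → κ, ∏ j, depolarizingKernel ε (a j) (x j) = 1 := by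
  simp [← Fintype.prod_sum, sum_depolarizingKernel]

variable {K : Type*} [Field K] [Fintype K] [DecidableEq K] {h : K → ℝ}

theorem sum_depolarizingKernel_mul_comp_affine (ε : ℝ) (hh : 𝔼 y, h y = 0) (a b c : K) :
    ∑ x, depolarizingKernel ε a x * h (c + b * x) =
      (if b ≠ 0 then 1 - ε else 1) * h (c + b * a) := by
  by_cases hb : b = 0
  · simp [hb, ← sum_mul, sum_depolarizingKernel]
  · have haffine : 𝔼 x, h (c + b * x) = 𝔼 y, h y :=
      Fintype.expect_equiv ((Equiv.mulLeft₀ b hb).trans (Equiv.addLeft c)) _ _ fun _ => rfl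
    rw [sum_depolarizingKernel_mul ε a fun x => h (c + b * x), haffine, hh, if_pos hb, mul_zero,
      add_zero]

theorem sum_prod_depolarizingKernel_mul (ε : ℝ) (hh : 𝔼 y, h y = 0) {n : ℕ} (a b : Fin n → K)
    (c : K) :
    ∑ x : Fin n → K, (∏ j, depolarizingKernel ε (a j) (x j)) * h (c + b ⬝ᵥ x) =
      (∏ j, if b j ≠ 0 then 1 - ε else 1) * h (c + b ⬝ᵥ a) := by
  induction n generalizing c with
  | zero => simp [dotProduct]
  | succ n ih =>
    rw [← (Fin.consEquiv fun _ : Fin (n + 1) => K).sum_comp, Fintype.sum_prod_type]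
    have htail (z : K) : ∑ y : Fin n → K,
        (∏ j, depolarizingKernel ε (a j) (Fin.cons (α := fun _ => K) z y j)) *
          h (c + b ⬝ᵥ Fin.cons (α := fun _ => K) z y) =
        (∏ j, if Fin.tail b j ≠ 0 then 1 - ε else 1) *
          (depolarizingKernel ε (a 0) z * h (c + Fin.tail b ⬝ᵥ Fin.tail a + b 0 * z)) := by
      rw [mul_left_comm, add_right_comm, ← ih (Fin.tail a) (Fin.tail b) (c + b 0 * z), mul_sum]
      simp only [Fin.prod_univ_succ, dotProduct, Fin.sum_univ_succ, Fin.cons_zero, Fin.cons_succ,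
        Fin.tail, mul_assoc, add_assoc]
    refine (sum_congr rfl fun z _ => htail z).trans ?_
    rw [← mul_sum, sum_depolarizingKernel_mul_comp_affine ε hh, Fin.prod_univ_succ,
      show c + b ⬝ᵥ a = c + Fin.tail b ⬝ᵥ Fin.tail a + b 0 * a 0 by
        simp only [dotProduct, Fin.sum_univ_succ, Fin.tail]; ring]
    exact (mul_left_comm _ _ _).trans (mul_assoc _ _ _).symm

theorem sum_prod_depolarizingKernel_mul_dotProduct (ε : ℝ) (hh : 𝔼 y, h y = 0) {n : ℕ}
    (a b : Fin n → K) :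
    ∑ x : Fin n → K, (∏ j, depolarizingKernel ε (a j) (x j)) * h (b ⬝ᵥ x) =
      (1 - ε) ^ hammingNorm b * h (b ⬝ᵥ a) := by
  simpa [prod_ite, hammingNorm] using sum_prod_depolarizingKernel_mul ε hh a b 0

end Noise

section Independence

theorem minDistance_dualCode_le_hammingNorm {p m n : ℕ} (B : Matrix (Fin m) (Fin n) (ZMod p))
    {u : Fin m → ZMod p} (hu : u ∈ dualCode B) (hu0 : u ≠ 0) :
    minDistance (dualCode B) ≤ hammingNorm u :=
  (iInf₂_le u hu).trans <| (iInf₂_le 0 (by simp [dualCode])).trans <| (iInf_le _ hu0).trans <| by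
    simp

theorem linearIndepOn_row_of_card_lt_minDistance {p m n : ℕ} [Fact p.Prime]
    (B : Matrix (Fin m) (Fin n) (ZMod p)) {T : Finset (Fin m)}
    (hT : T.card < minDistance (dualCode B)) : LinearIndepOn (ZMod p) B.row T := by
  rw [linearIndepOn_finset_iff]
  intro c hc i hi
  by_contra hci
  set u : Fin m → ZMod p := fun i => if i ∈ T then c i else 0 with hu
  have hker : u ∈ dualCode B := by
    simpa [dualCode, mulVec_transpose, vecMul_eq_sum, hu, ite_smul, Matrix.row] using hc
  have hu0 : u ≠ 0 := fun h => hci (by simpa [hu, hi] using congrFun h i)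
  have hnorm : hammingNorm u ≤ T.card :=
    card_le_card fun j hj => by_contra fun hjT => by simp [hu, hjT] at hj
  exact (hT.trans_le (minDistance_dualCode_le_hammingNorm B hker hu0)).not_ge
    (Nat.cast_le.mpr hnorm)

theorem minDistance_dualCode_le {p m n : ℕ} [Fact p.Prime] (B : Matrix (Fin m) (Fin n) (ZMod p))
    (hnm : n < m) : minDistance (dualCode B) ≤ m := by
  by_contra! hm
  have hrows : LinearIndepOn (ZMod p) B.row (univ : Finset (Fin m)) :=
    linearIndepOn_row_of_card_lt_minDistance B (by simpa using hm)
  rw [coe_univ, linearIndepOn_univ_iff] at hrows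
  exact hnm.not_ge (by simpa using hrows.fintype_card_le_finrank)

theorem expect_comp_of_surjective {G H : Type*} [AddGroup G] [Fintype G] [AddGroup H] [Fintype H]
    {φ : G →+ H} (hφ : Function.Surjective φ) (F : H → ℝ) : 𝔼 x, F (φ x) = 𝔼 y, F y := by
  have hshift (z : H) : 𝔼 x, F (φ x + z) = 𝔼 x, F (φ x) := by
    obtain ⟨v, rfl⟩ := hφ z
    exact Fintype.expect_equiv (Equiv.addRight v) _ _ fun x => by simp
  calc 𝔼 x, F (φ x) = 𝔼 z, 𝔼 x, F (φ x + z) := by simp [hshift]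
    _ = 𝔼 x, 𝔼 z, F (φ x + z) := expect_comm ..
    _ = 𝔼 x : G, 𝔼 y, F y := expect_congr rfl fun x _ =>
        Fintype.expect_equiv (Equiv.addLeft (φ x)) _ _ fun _ => rfl
    _ = 𝔼 y, F y := Fintype.expect_const _

theorem expect_prod_apply {ι K : Type*} [Fintype ι] [DecidableEq ι] [Fintype K]
    (h : ι → K → ℝ) : 𝔼 y : ι → K, ∏ i, h i (y i) = ∏ i, 𝔼 y, h i y := by
  simp [Fintype.expect_eq_sum_div_card, prod_div_distrib, Fintype.prod_sum]

variable {ι κ K : Type*} [Fintype κ] [Field K] {B : Matrix ι κ K}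

theorem mulVec_surjective_of_linearIndependent [Finite ι] (hB : LinearIndependent K B.row) :
    Function.Surjective B.mulVec := by
  cases nonempty_fintype ι
  rw [← coe_mulVecLin, ← LinearMap.range_eq_top]
  apply Submodule.eq_top_of_finrank_eq
  simpa [Matrix.rank] using hB.rank_matrix

theorem expect_prod_mulVec [DecidableEq κ] [Fintype K] {T : Finset ι} (hT : LinearIndepOn K B.row T)
    (h : ι → K → ℝ) :
    𝔼 x, ∏ i ∈ T, h i ((B *ᵥ x) i) = ∏ i ∈ T, 𝔼 y, h i y := by
  classical
  let A : Matrix T κ K := B.submatrix (↑) id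
  have hsurj : Function.Surjective A.mulVec := mulVec_surjective_of_linearIndependent hT
  have hexp := expect_comp_of_surjective (φ := A.mulVecLin.toAddMonoidHom) hsurj
    fun y => ∏ i : T, h i (y i)
  rw [expect_prod_apply] at hexp
  rw [← prod_coe_sort T fun i => 𝔼 y, h i y, ← hexp]
  exact expect_congr rfl fun x _ => (prod_coe_sort T fun i => h i ((B *ᵥ x) i)).symm

end Independence

section Moments

variable {ι κ K : Type*} [DecidableEq ι] [Fintype κ] [DecidableEq κ] [Field K] [Fintype K]
  {B : Matrix ι κ K} {v : ι → K → ℝ} {γ : ℝ}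

theorem expect_prod_mul_prod (h1 : ∀ i, 𝔼 y, v i y = 0) (h2 : ∀ i, 𝔼 y, v i y ^ 2 = 1)
    {S S' : Finset ι} (hB : LinearIndepOn K B.row (S ∪ S' : Finset ι)) :
    𝔼 x, (∏ j ∈ S, v j ((B *ᵥ x) j)) * ∏ j ∈ S', v j ((B *ᵥ x) j) = if S = S' then 1 else 0 := by
  set h : ι → K → ℝ := fun j y => (if j ∈ S then v j y else 1) * if j ∈ S' then v j y else 1 with hh
  have hfactor (j : ι) : 𝔼 y, h j y = if (j ∈ S ↔ j ∈ S') then 1 else 0 := by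
    by_cases hS : j ∈ S <;> by_cases hS' : j ∈ S' <;> simp [hh, hS, hS', h1, ← sq, h2]
  have hprod (x : κ → K) : (∏ j ∈ S, v j ((B *ᵥ x) j)) * ∏ j ∈ S', v j ((B *ᵥ x) j) =
      ∏ j ∈ S ∪ S', h j ((B *ᵥ x) j) := by
    simp only [hh, prod_mul_distrib, prod_ite_mem, union_inter_cancel_left,
      union_inter_cancel_right]
  simp only [hprod, expect_prod_mulVec hB, hfactor]
  split_ifs with hSS'
  · simp [hSS']
  · obtain ⟨j, hj⟩ : ∃ j, ¬(j ∈ S ↔ j ∈ S') := by simpa [Finset.ext_iff] using hSS'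
    exact prod_eq_zero (i := j) (by simp only [mem_union]; tauto) (if_neg hj)

theorem expect_mul_prod_mul_prod (h1 : ∀ i, 𝔼 y, v i y = 0) (h2 : ∀ i, 𝔼 y, v i y ^ 2 = 1)
    (h3 : ∀ i, 𝔼 y, v i y ^ 3 = γ) (i : ι) {S S' : Finset ι}
    (hB : LinearIndepOn K B.row (insert i (S ∪ S') : Finset ι)) :
    𝔼 x, v i ((B *ᵥ x) i) * ((∏ j ∈ S, v j ((B *ᵥ x) j)) * ∏ j ∈ S', v j ((B *ᵥ x) j)) =
      (if S = S' then if i ∈ S then γ else 0 else 0) +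
        (if S.erase i = S' then if i ∈ S then 1 else 0 else 0) +
        (if insert i S = S' then if i ∈ S then 0 else 1 else 0) := by
  set T := insert i (S ∪ S') with hT
  set h : ι → K → ℝ := fun j y =>
    (if j = i then v j y else 1) * ((if j ∈ S then v j y else 1) * if j ∈ S' then v j y else 1)
    with hh
  have hfactor {j : ι} (hj : j ≠ i) : 𝔼 y, h j y = if (j ∈ S ↔ j ∈ S') then 1 else 0 := by
    by_cases hS : j ∈ S <;> by_cases hS' : j ∈ S' <;> simp [hh, hj, hS, hS', h1, ← sq, h2]
  have hfactor_self : 𝔼 y, h i y =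
      if i ∈ S then if i ∈ S' then γ else 1 else if i ∈ S' then 1 else 0 := by
    by_cases hS : i ∈ S <;> by_cases hS' : i ∈ S' <;>
      simp [hh, hS, hS', h1, ← sq, h2, ← pow_succ', h3]
  have hprod (x : κ → K) : v i ((B *ᵥ x) i) *
      ((∏ j ∈ S, v j ((B *ᵥ x) j)) * ∏ j ∈ S', v j ((B *ᵥ x) j)) =
      ∏ j ∈ T, h j ((B *ᵥ x) j) := by
    have hS : T ∩ S = S := inter_eq_right.mpr fun j hj => by simp [hT, hj]
    have hS' : T ∩ S' = S' := inter_eq_right.mpr fun j hj => by simp [hT, hj]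
    have hi : i ∈ T := mem_insert_self ..
    simp only [hh, prod_mul_distrib, prod_ite_mem, prod_ite_eq', hS, hS', hi, if_true]
  simp only [hprod, expect_prod_mulVec hB]
  by_cases hagree : ∀ j ≠ i, (j ∈ S ↔ j ∈ S')
  · rw [prod_eq_single_of_mem i (mem_insert_self ..) fun j _ hj => by
      rw [hfactor hj, if_pos (hagree j hj)], hfactor_self]
    by_cases hS : i ∈ S <;> by_cases hS' : i ∈ S' <;> grind
  · push Not at hagree
    obtain ⟨j, hj, hSS'⟩ := hagree
    rw [prod_eq_zero (i := j) (by grind) (by rw [hfactor hj, if_neg (by tauto)])]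
    grind

end Moments

section PowersetCard

variable {ι : Type*} [Fintype ι] [DecidableEq ι]

theorem sum_powersetCard_ite_notMem (i : ι) (k : ℕ) :
    ∑ S ∈ univ.powersetCard k, (if i ∈ S then (0 : ℝ) else 1) =
      (k + 1 : ℕ) / Fintype.card ι * (Fintype.card ι).choose (k + 1) := by
  obtain ⟨n, hn⟩ : ∃ n, Fintype.card ι = n + 1 :=
    Nat.exists_eq_add_one.mpr (Fintype.card_pos_iff.mpr ⟨i⟩)
  have hfilter : {S ∈ (univ : Finset ι).powersetCard k | i ∉ S} =
      (univ.erase i).powersetCard k := by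
    ext S
    simp [subset_erase, and_comm]
  have hchoose : ((n + 1 : ℕ) : ℝ) * n.choose k = (n + 1).choose (k + 1) * (k + 1 : ℕ) := by
    exact_mod_cast Nat.add_one_mul_choose_eq n k
  simp_rw [← ite_not (i ∈ _)]
  rw [sum_boole, hfilter, card_powersetCard, card_erase_of_mem (mem_univ i), card_univ, hn,
    Nat.add_sub_cancel, div_mul_eq_mul_div, eq_div_iff (by positivity)]
  linarith

theorem sum_powersetCard_ite_mem (i : ι) (k : ℕ) :
    ∑ S ∈ univ.powersetCard k, (if i ∈ S then (1 : ℝ) else 0) =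
      k / Fintype.card ι * (Fintype.card ι).choose k := by
  have hcard : (0 : ℝ) < Fintype.card ι := Nat.cast_pos.mpr (Fintype.card_pos_iff.mpr ⟨i⟩)
  have hsum : ∑ S ∈ univ.powersetCard k, (if i ∈ S then (1 : ℝ) else 0) +
      ∑ S ∈ univ.powersetCard k, (if i ∈ S then (0 : ℝ) else 1) = (Fintype.card ι).choose k := by
    rw [← sum_add_distrib]
    simp [ite_add_ite]
  have hpascal : ((Fintype.card ι + 1 : ℕ) : ℝ) * (Fintype.card ι).choose k =
      (Fintype.card ι + 1).choose (k + 1) * (k + 1 : ℕ) := by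
    exact_mod_cast Nat.add_one_mul_choose_eq (Fintype.card ι) k
  rw [sum_powersetCard_ite_notMem] at hsum
  rw [eq_sub_of_add_eq hsum]
  rw [Nat.choose_succ_succ] at hpascal
  push_cast at hpascal ⊢
  field_simp
  linarith

end PowersetCard

section ElementarySymmetric

variable {ι κ K : Type*} [Fintype ι] [Fintype κ]

/-- The `k`-th elementary symmetric function of the values `v i (b_i · x)`, where `b_i` are the rows
of `B`. -/
def rowEsymm [CommRing K] (B : Matrix ι κ K) (v : ι → K → ℝ) (k : ℕ) (x : κ → K) : ℝ :=
  ∑ S ∈ univ.powersetCard k, ∏ i ∈ S, v i ((B *ᵥ x) i)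

/-- The function `rowEsymm`, scaled to norm `1` in `L²` of the uniform measure when the `v i` are
standardized and the rows of `B` are sufficiently independent. -/
noncomputable def normalizedEsymm [CommRing K] (B : Matrix ι κ K) (v : ι → K → ℝ) (k : ℕ)
    (x : κ → K) : ℝ :=
  rowEsymm B v k x / √((Fintype.card ι).choose k)

variable [DecidableEq κ] [Field K] [Fintype K] {B : Matrix ι κ K} {v : ι → K → ℝ} {γ : ℝ}

theorem expect_rowEsymm_mul_rowEsymm (h1 : ∀ i, 𝔼 y, v i y = 0) (h2 : ∀ i, 𝔼 y, v i y ^ 2 = 1)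
    {k k' : ℕ} (hB : ∀ T : Finset ι, T.card ≤ k + k' → LinearIndepOn K B.row T) :
    𝔼 x, rowEsymm B v k x * rowEsymm B v k' x =
      if k = k' then ((Fintype.card ι).choose k : ℝ) else 0 := by
  classical
  have hpair {S S' : Finset ι} (hS : S ∈ univ.powersetCard k) (hS' : S' ∈ univ.powersetCard k') :
      LinearIndepOn K B.row (S ∪ S' : Finset ι) :=
    hB _ ((card_union_le S S').trans_eq (by rw [(mem_powersetCard.mp hS).2,
      (mem_powersetCard.mp hS').2]))
  calc 𝔼 x, rowEsymm B v k x * rowEsymm B v k' x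
      = ∑ S ∈ univ.powersetCard k, ∑ S' ∈ univ.powersetCard k', if S = S' then 1 else 0 := by
        simp only [rowEsymm, sum_mul_sum, expect_sum_comm]
        exact sum_congr rfl fun S hS => sum_congr rfl fun S' hS' =>
          expect_prod_mul_prod h1 h2 (hpair hS hS')
    _ = ∑ _S ∈ (univ : Finset ι).powersetCard k, if k = k' then (1 : ℝ) else 0 :=
        sum_congr rfl fun S hS => by simp [(mem_powersetCard.mp hS).2]
    _ = _ := by split_ifs <;> simp

theorem expect_mul_rowEsymm_mul_rowEsymm (h1 : ∀ i, 𝔼 y, v i y = 0)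
    (h2 : ∀ i, 𝔼 y, v i y ^ 2 = 1) (h3 : ∀ i, 𝔼 y, v i y ^ 3 = γ) (i : ι) {k k' : ℕ}
    (hB : ∀ T : Finset ι, T.card ≤ k + k' + 1 → LinearIndepOn K B.row T) :
    𝔼 x, v i ((B *ᵥ x) i) * (rowEsymm B v k x * rowEsymm B v k' x) =
      if k = k' then γ * (k / Fintype.card ι * (Fintype.card ι).choose k)
      else if k + 1 = k' then (k' : ℝ) / Fintype.card ι * (Fintype.card ι).choose k'
      else if k' + 1 = k then (k : ℝ) / Fintype.card ι * (Fintype.card ι).choose k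
      else 0 := by
  classical
  have htriple {S S' : Finset ι} (hS : S ∈ univ.powersetCard k) (hS' : S' ∈ univ.powersetCard k') :
      LinearIndepOn K B.row (insert i (S ∪ S') : Finset ι) :=
    hB _ ((card_insert_le _ _).trans (Nat.succ_le_succ ((card_union_le S S').trans_eq
      (by rw [(mem_powersetCard.mp hS).2, (mem_powersetCard.mp hS').2]))))
  calc 𝔼 x, v i ((B *ᵥ x) i) * (rowEsymm B v k x * rowEsymm B v k' x)
      = ∑ S ∈ univ.powersetCard k, ∑ S' ∈ univ.powersetCard k',
          ((if S = S' then if i ∈ S then γ else 0 else 0) +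
            (if S.erase i = S' then if i ∈ S then 1 else 0 else 0) +
            (if insert i S = S' then if i ∈ S then 0 else 1 else 0)) := by
        simp_rw [rowEsymm, sum_mul_sum, mul_sum, expect_sum_comm]
        exact sum_congr rfl fun S hS => sum_congr rfl fun S' hS' =>
          expect_mul_prod_mul_prod h1 h2 h3 i (htriple hS hS')
    _ = ∑ S ∈ (univ : Finset ι).powersetCard k,
          if k = k' then γ * (if i ∈ S then 1 else 0)
          else if k + 1 = k' then if i ∈ S then 0 else 1
          else if k' + 1 = k then if i ∈ S then 1 else 0
          else 0 := by
        refine sum_congr rfl fun S hS => ?_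
        simp only [sum_add_distrib, sum_ite_eq, mem_powersetCard_univ]
        by_cases hi : i ∈ S
        · have := card_erase_add_one hi
          grind
        · have := card_insert_of_notMem hi
          grind
    _ = _ := by
        split_ifs with _ hk
        · rw [← mul_sum, sum_powersetCard_ite_mem]
        · rw [sum_powersetCard_ite_notMem, hk]
        · rw [sum_powersetCard_ite_mem]
        · simp

theorem expect_normalizedEsymm_mul_normalizedEsymm (h1 : ∀ i, 𝔼 y, v i y = 0)
    (h2 : ∀ i, 𝔼 y, v i y ^ 2 = 1) {k k' : ℕ}
    (hB : ∀ T : Finset ι, T.card ≤ k + k' → LinearIndepOn K B.row T) (hk : k ≤ Fintype.card ι) :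
    𝔼 x, normalizedEsymm B v k x * normalizedEsymm B v k' x = if k = k' then 1 else 0 := by
  simp only [normalizedEsymm, div_mul_div_comm, ← expect_div,
    expect_rowEsymm_mul_rowEsymm h1 h2 hB]
  split_ifs with hkk'
  · subst hkk'
    rw [Real.mul_self_sqrt (Nat.cast_nonneg _), div_self]
    exact_mod_cast (Nat.choose_pos hk).ne'
  · exact zero_div _

theorem div_mul_choose_div_sqrt {m k : ℕ} (hk : k + 1 ≤ m) :
    ((k + 1 : ℕ) : ℝ) / m * m.choose (k + 1) / (√(m.choose k) * √(m.choose (k + 1))) =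
      √((k + 1 : ℕ) * ((m : ℝ) - (k + 1 : ℕ) + 1)) / m := by
  have hpos : (0 : ℝ) < m.choose k := by exact_mod_cast Nat.choose_pos (by omega)
  have hpos' : (0 : ℝ) < m.choose (k + 1) := by exact_mod_cast Nat.choose_pos hk
  have hratio : (m : ℝ) - (k + 1 : ℕ) + 1 = (k + 1 : ℕ) * m.choose (k + 1) / m.choose k := by
    rw [eq_div_iff hpos.ne']
    have := congrArg (Nat.cast (R := ℝ)) (Nat.choose_succ_right_eq m k)
    push_cast [Nat.cast_sub (show k ≤ m by omega)] at this ⊢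
    linarith
  have hsqrt : √((k + 1 : ℕ) * ((m : ℝ) - (k + 1 : ℕ) + 1)) =
      (k + 1 : ℕ) * (√(m.choose (k + 1)) / √(m.choose k)) := by
    rw [hratio, ← Real.sqrt_div hpos'.le, mul_div_assoc, ← mul_assoc,
      Real.sqrt_mul (by positivity), Real.sqrt_mul_self (by positivity)]
  rw [hsqrt]
  nth_rw 1 [← Real.mul_self_sqrt hpos'.le]
  field_simp

theorem expect_mul_normalizedEsymm_mul_normalizedEsymm (h1 : ∀ i, 𝔼 y, v i y = 0)
    (h2 : ∀ i, 𝔼 y, v i y ^ 2 = 1) (h3 : ∀ i, 𝔼 y, v i y ^ 3 = γ) (i : ι) {l : ℕ}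
    (hB : ∀ T : Finset ι, T.card ≤ 2 * l + 1 → LinearIndepOn K B.row T) (hl : l ≤ Fintype.card ι)
    (k k' : Fin (l + 1)) :
    𝔼 x, v i ((B *ᵥ x) i) * (normalizedEsymm B v k x * normalizedEsymm B v k' x) =
      tridiagonal (Fintype.card ι) l γ k k' / Fintype.card ι := by
  have hk := k.is_le
  have hk' := k'.is_le
  have hnormalize : 𝔼 x, v i ((B *ᵥ x) i) * (normalizedEsymm B v k x * normalizedEsymm B v k' x) =
      (𝔼 x, v i ((B *ᵥ x) i) * (rowEsymm B v k x * rowEsymm B v k' x)) /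
        (√((Fintype.card ι).choose k) * √((Fintype.card ι).choose k')) := by
    rw [expect_div]
    exact expect_congr rfl fun x _ => by simp only [normalizedEsymm]; ring
  rw [hnormalize, expect_mul_rowEsymm_mul_rowEsymm h1 h2 h3 i fun T hT => hB T (by omega)]
  simp only [tridiagonal, Fin.ext_iff]
  split_ifs with h_eq h_succ h_pred
  · have : ((Fintype.card ι).choose k : ℝ) ≠ 0 := by
      exact_mod_cast (Nat.choose_pos (hk.trans hl)).ne'
    rw [← h_eq, Real.mul_self_sqrt (Nat.cast_nonneg _)]
    field_simp
  · rw [← h_succ, div_mul_choose_div_sqrt (by omega)]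
  · rw [← h_pred, mul_comm (√_), div_mul_choose_div_sqrt (by omega)]
  · simp

end ElementarySymmetric

section StandardizedIndicator

variable {κ : Type*} [Fintype κ] [DecidableEq κ] {F : Finset κ} {q : ℝ}

/-- The indicator function of `F`, standardized to mean `0` and variance `1`; `q` stands for the
density of `F`. -/
noncomputable def stdIndicator (q : ℝ) (F : Finset κ) (y : κ) : ℝ :=
  if y ∈ F then (1 - q) / √(q * (1 - q)) else -q / √(q * (1 - q))

/-- The skewness of a Bernoulli variable of parameter `q`. -/
noncomputable def skewness (q : ℝ) : ℝ := (1 - 2 * q) / √(q * (1 - q))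

theorem skewness_div {p : ℝ} (hp : 0 < p) (r : ℝ) :
    skewness (r / p) = (p - 2 * r) / √(r * (p - r)) := by
  have hvar : r / p * (1 - r / p) = r * (p - r) / p ^ 2 := by field_simp
  rw [skewness, hvar, Real.sqrt_div' _ (sq_nonneg p), Real.sqrt_sq hp.le]
  field_simp

theorem expect_ite_mem_eq [Nonempty κ] (hF : (F.card : ℝ) / Fintype.card κ = q) (a b : ℝ) :
    𝔼 y, (if y ∈ F then a else b) = q * a + (1 - q) * b := by
  have hcard : (Fintype.card κ : ℝ) ≠ 0 := Nat.cast_ne_zero.mpr Fintype.card_ne_zero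
  have hcompl : ((Fᶜ.card : ℕ) : ℝ) = Fintype.card κ - F.card := by
    rw [card_compl, Nat.cast_sub (card_le_univ F)]
  rw [Fintype.expect_eq_sum_div_card, sum_ite, ← hF]
  simp only [filter_mem_eq_inter, univ_inter, filter_notMem_eq_sdiff, ← compl_eq_univ_sdiff,
    sum_const, nsmul_eq_mul, hcompl]
  field_simp

theorem expect_stdIndicator [Nonempty κ] (hF : (F.card : ℝ) / Fintype.card κ = q) :
    𝔼 y, stdIndicator q F y = 0 := by
  simp only [stdIndicator]
  rw [expect_ite_mem_eq hF]
  ring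

theorem expect_stdIndicator_sq [Nonempty κ] (hF : (F.card : ℝ) / Fintype.card κ = q) (hq0 : 0 < q)
    (hq1 : q < 1) : 𝔼 y, stdIndicator q F y ^ 2 = 1 := by
  have hq1' : 0 < 1 - q := sub_pos.mpr hq1
  have hvar : 0 < q * (1 - q) := mul_pos hq0 hq1'
  simp only [stdIndicator, ite_pow, div_pow, Real.sq_sqrt hvar.le]
  rw [expect_ite_mem_eq hF]
  field_simp
  ring

theorem expect_stdIndicator_cube [Nonempty κ] (hF : (F.card : ℝ) / Fintype.card κ = q)
    (hq0 : 0 < q) (hq1 : q < 1) : 𝔼 y, stdIndicator q F y ^ 3 = skewness q := by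
  have hq1' : 0 < 1 - q := sub_pos.mpr hq1
  have hvar : 0 < q * (1 - q) := mul_pos hq0 hq1'
  simp only [stdIndicator, ite_pow, div_pow, pow_succ √_ 2, Real.sq_sqrt hvar.le, skewness]
  rw [expect_ite_mem_eq hF]
  field_simp
  ring

omit [Fintype κ] in
theorem ite_mem_eq_add_stdIndicator (hq0 : 0 < q) (hq1 : q < 1) (y : κ) :
    (if y ∈ F then (1 : ℝ) else 0) = q + √(q * (1 - q)) * stdIndicator q F y := by
  have hsqrt : √(q * (1 - q)) ≠ 0 := (Real.sqrt_pos.mpr (mul_pos hq0 (sub_pos.mpr hq1))).ne'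
  unfold stdIndicator
  split_ifs <;> field_simp <;> ring

namespace MaxLinSAT

variable {p m n : ℕ} {I : MaxLinSAT p m n}

theorem f_eq_add_stdIndicator (hq0 : 0 < q) (hq1 : q < 1) (i : Fin m) (y : ZMod p) :
    I.f i y = 2 * q - 1 + 2 * √(q * (1 - q)) * stdIndicator q (I.F i) y := by
  rw [show I.f i y = 2 * (if y ∈ I.F i then 1 else 0) - 1 by unfold f; split_ifs <;> norm_num,
    ite_mem_eq_add_stdIndicator hq0 hq1]
  ring

variable [NeZero p] (hF : ∀ i, ((I.F i).card : ℝ) / p = q)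
include hF

theorem fMean_eq (i : Fin m) : I.fMean i = 2 * q - 1 := by
  have hexpect := expect_ite_mem_eq (F := I.F i) (q := q) (by simpa [ZMod.card] using hF i) 1 (-1)
  rw [Fintype.expect_eq_sum_div_card, ZMod.card] at hexpect
  rw [fMean]
  simp only [f, hexpect]
  ring

theorem f_sub_fMean (hq0 : 0 < q) (hq1 : q < 1) (i : Fin m) (y : ZMod p) :
    I.f i y - I.fMean i = 2 * √(q * (1 - q)) * stdIndicator q (I.F i) y := by
  rw [f_eq_add_stdIndicator hq0 hq1, fMean_eq hF]
  ring

theorem phi_eq (hq0 : 0 < q) (hq1 : q < 1) (i : Fin m) :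
    I.phi i = 2 * √(q * (1 - q)) * √p := by
  have hsum : ∑ y, stdIndicator q (I.F i) y ^ 2 = p := by
    rw [← Fintype.card_mul_expect,
      expect_stdIndicator_sq (by simpa [ZMod.card] using hF i) hq0 hq1, ZMod.card, mul_one]
  simp only [phi, sq_abs, f_sub_fMean hF hq0 hq1, mul_pow _ (stdIndicator _ _ _)]
  rw [← mul_sum, hsum, Real.sqrt_mul (sq_nonneg _), Real.sqrt_sq (by positivity)]

theorem g_eq_stdIndicator_div (hq0 : 0 < q) (hq1 : q < 1) (i : Fin m) (y : ZMod p) :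
    I.g i y = stdIndicator q (I.F i) y / √p := by
  have : 0 < √(q * (1 - q)) := Real.sqrt_pos.mpr (mul_pos hq0 (sub_pos.mpr hq1))
  rw [g, f_sub_fMean hF hq0 hq1, phi_eq hF hq0 hq1, mul_div_mul_left _ _ (by positivity)]

theorem basisState_eq_normalizedEsymm (hq0 : 0 < q) (hq1 : q < 1) (k : ℕ) (x : Fin n → ZMod p) :
    I.basisState k x =
      ((normalizedEsymm I.B (fun i => stdIndicator q (I.F i)) k x / √((p : ℝ) ^ n) : ℝ) : ℂ) := by
  have hp : (0 : ℝ) < p := Nat.cast_pos.mpr (NeZero.pos p)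
  have hesymm : I.elemSym k x = rowEsymm I.B (fun i => stdIndicator q (I.F i)) k x / √p ^ k := by
    rw [elemSym, rowEsymm, sum_div]
    refine sum_congr rfl fun S hS => ?_
    simp only [g_eq_stdIndicator_div hF hq0 hq1, prod_div_distrib, prod_const,
      (mem_powersetCard.mp hS).2]
  have hscale : √((p : ℝ) ^ ((n : ℤ) - k)) * √p ^ k = √((p : ℝ) ^ n) := by
    rw [eq_comm, Real.sqrt_eq_iff_mul_self_eq (by positivity) (by positivity), mul_mul_mul_comm,
      ← mul_pow, Real.mul_self_sqrt (by positivity), Real.mul_self_sqrt hp.le, zpow_sub₀ hp.ne',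
      zpow_natCast, zpow_natCast, div_mul_cancel₀ _ (by positivity)]
  rw [basisState, Complex.ofReal_inj, hesymm, normalizedEsymm, Fintype.card_fin, ← hscale,
    Real.sqrt_mul (by positivity)]
  ring

end MaxLinSAT

end StandardizedIndicator

section PolynomialStates

/-- Newton's identities express the elementary symmetric functions through the power sums. -/
theorem exists_polynomial_eval_eq_esymm {ι X R : Type*} [Fintype ι] [Field R] [CharZero R]
    {y : X → ι → R} {f : X → R}
    (hpsum : ∀ j : ℕ, 0 < j → ∃ Q : R[X], Q.natDegree ≤ j ∧ ∀ x, ∑ i, y x i ^ j = Q.eval (f x))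
    (k : ℕ) :
    ∃ Q : R[X], Q.natDegree ≤ k ∧
      ∀ x, ∑ S ∈ univ.powersetCard k, ∏ i ∈ S, y x i = Q.eval (f x) := by
  classical
  choose! P hPdeg hP using hpsum
  induction k using Nat.strong_induction_on with
  | _ k ih =>
    rcases Nat.eq_zero_or_pos k with rfl | hk
    · exact ⟨1, by simp, by simp⟩
    choose! Q hQdeg hQ using ih
    refine ⟨C ((-1) ^ (k + 1) / (k : R)) *
      ∑ a ∈ antidiagonal k with a.1 < k, C ((-1) ^ a.1) * Q a.1 * P a.2, ?_, fun x => ?_⟩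
    · refine (natDegree_C_mul_le _ _).trans (natDegree_sum_le_of_forall_le _ _ fun a ha => ?_)
      rw [mem_filter, HasAntidiagonal.mem_antidiagonal] at ha
      exact (natDegree_mul_le_of_le ((natDegree_C_mul_le _ _).trans (hQdeg _ ha.2))
        (hPdeg _ (by omega))).trans_eq ha.1
    · have hNewton := congrArg (MvPolynomial.aeval (y x)) (MvPolynomial.mul_esymm_eq_sum ι R k)
      simp only [map_mul, map_sum, map_pow, map_neg, map_one, map_natCast, MvPolynomial.esymm,
        MvPolynomial.psum, map_prod, MvPolynomial.aeval_X] at hNewton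
      rw [eval_mul, eval_C, eval_finsetSum, div_mul_eq_mul_div,
        eq_div_iff (Nat.cast_ne_zero.mpr hk.ne'), mul_comm, hNewton]
      refine congrArg _ (sum_congr rfl fun a ha => ?_)
      rw [mem_filter, HasAntidiagonal.mem_antidiagonal] at ha
      rw [eval_mul, eval_mul, eval_C, ← hQ _ ha.2, ← hP _ (by omega)]

namespace MaxLinSAT

variable {p m n : ℕ} [NeZero p] {I : MaxLinSAT p m n} {q : ℝ}
  (hF : ∀ i, ((I.F i).card : ℝ) / p = q)
include hF

/-- Since `f_i` takes only the values `±1`, every power of the affine function `g_i` of `f_i` is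
again an affine function of `f_i`. -/
theorem exists_polynomial_eval_eq_sum_g_pow (hq0 : 0 < q) (hq1 : q < 1) {j : ℕ} (hj : 0 < j) :
    ∃ Q : ℝ[X], Q.natDegree ≤ j ∧
      ∀ x, ∑ i, I.g i ((I.B *ᵥ x) i) ^ j = Q.eval (I.objective x) := by
  set φ : ℝ → ℝ := fun t => ((t - (2 * q - 1)) / (2 * √(q * (1 - q)) * √p)) ^ j
  have haffine (i : Fin m) (y : ZMod p) :
      I.g i y ^ j = (φ 1 - φ (-1)) / 2 * I.f i y + (φ 1 + φ (-1)) / 2 := by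
    have : I.g i y ^ j = φ (I.f i y) := by rw [g, fMean_eq hF, phi_eq hF hq0 hq1]
    rw [this, f]
    split_ifs <;> ring
  refine ⟨C ((φ 1 - φ (-1)) / 2) * X + C (m * ((φ 1 + φ (-1)) / 2)), natDegree_linear_le.trans hj,
    fun x => ?_⟩
  simp only [haffine, sum_add_distrib, ← mul_sum, eval_add, eval_mul, eval_C, eval_X, objective,
    sum_const, card_univ, Fintype.card_fin, nsmul_eq_mul]

theorem exists_polynomial_eval_eq_basisState (hq0 : 0 < q) (hq1 : q < 1) (k : ℕ) :
    ∃ Q : ℂ[X], Q.natDegree ≤ k ∧ ∀ x, I.basisState k x = Q.eval (I.objective x : ℂ) := by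
  obtain ⟨Q, hQdeg, hQ⟩ := exists_polynomial_eval_eq_esymm
    (fun j hj => exists_polynomial_eval_eq_sum_g_pow hF hq0 hq1 hj) k
  refine ⟨(C (1 / √((p : ℝ) ^ ((n : ℤ) - k) * m.choose k)) * Q).map Complex.ofRealHom,
    natDegree_map_le.trans ((natDegree_C_mul_le _ _).trans hQdeg), fun x => ?_⟩
  have heval := eval_map_apply Complex.ofRealHom (I.objective x)
    (p := C (1 / √((p : ℝ) ^ ((n : ℤ) - k) * m.choose k)) * Q)
  rw [eval_mul, eval_C, ← hQ] at heval
  exact heval.symm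

theorem exists_polyState_eq_dqiState (hq0 : 0 < q) (hq1 : q < 1) {l : ℕ}
    (w : EuclideanSpace ℂ (Fin (l + 1))) :
    ∃ P : ℂ[X], P.natDegree ≤ l ∧ I.polyState P = I.dqiState w := by
  choose Q hQdeg hQ using exists_polynomial_eval_eq_basisState hF hq0 hq1
  refine ⟨∑ k : Fin (l + 1), C (w k) * Q k, natDegree_sum_le_of_forall_le _ _ fun k _ =>
    (natDegree_C_mul_le _ _).trans ((hQdeg k).trans k.is_le), funext fun x => ?_⟩
  simp only [polyState, dqiState, eval_finsetSum, eval_mul, eval_C, hQ]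

end MaxLinSAT

end PolynomialStates

section LargestEigenvalue

variable {ι : Type*} [Fintype ι] [DecidableEq ι] {A : Matrix ι ι ℝ}

/-- The largest eigenvalue of a real matrix, meaningful when there is one, as for a nonempty
symmetric matrix. -/
noncomputable def largestEigenvalue (A : Matrix ι ι ℝ) : ℝ :=
  sSup {x | Module.End.HasEigenvalue (toLin' A) x}

theorem hasEigenvalue_toLin'_iff_mem_spectrum {x : ℝ} :
    Module.End.HasEigenvalue (toLin' A) x ↔ x ∈ spectrum ℝ A := by
  rw [Module.End.hasEigenvalue_iff_mem_spectrum, spectrum_toLin']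

theorem isGreatest_largestEigenvalue [Nonempty ι] (hA : A.IsHermitian) :
    IsGreatest {x | Module.End.HasEigenvalue (toLin' A) x} (largestEigenvalue A) :=
  (Module.End.finite_hasEigenvalue (toLin' A)).isCompact.isGreatest_sSup
    ⟨_, hasEigenvalue_toLin'_iff_mem_spectrum.mpr
      (hA.eigenvalues_mem_spectrum_real (Classical.arbitrary ι))⟩

theorem posSemidef_algebraMap_largestEigenvalue_sub [Nonempty ι] (hA : A.IsHermitian) :
    (algebraMap ℝ (Matrix ι ι ℝ) (largestEigenvalue A) - A).PosSemidef := by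
  have hM : (algebraMap ℝ (Matrix ι ι ℝ) (largestEigenvalue A) - A).IsHermitian :=
    (isHermitian_diagonal _).sub hA
  refine hM.posSemidef_iff_eigenvalues_nonneg.mpr fun i => ?_
  have hi := hM.eigenvalues_mem_spectrum_real i
  rw [← spectrum.singleton_sub_eq, Set.singleton_sub] at hi
  obtain ⟨x, hx, hxi⟩ := hi
  rw [Pi.zero_apply, ← hxi]
  exact sub_nonneg.mpr ((isGreatest_largestEigenvalue hA).2
    (hasEigenvalue_toLin'_iff_mem_spectrum.mpr hx))

theorem dotProduct_mulVec_le_largestEigenvalue_mul [Nonempty ι] (hA : A.IsHermitian)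
    (x : ι → ℝ) : x ⬝ᵥ A *ᵥ x ≤ largestEigenvalue A * (x ⬝ᵥ x) := by
  have := (posSemidef_algebraMap_largestEigenvalue_sub hA).dotProduct_mulVec_nonneg x
  rwa [Algebra.algebraMap_eq_smul_one, sub_mulVec, smul_mulVec, one_mulVec, star_trivial,
    dotProduct_sub, dotProduct_smul, smul_eq_mul, sub_nonneg] at this

end LargestEigenvalue

section HermitianForm

variable {ι : Type*} [Fintype ι]

/-- The value `w† A w` of the quadratic form of a real symmetric matrix `A` at a complex vector
`w`; for an arbitrary real matrix it is the real part of `w† A w`. -/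
def hermitianForm (A : Matrix ι ι ℝ) (w : ι → ℂ) : ℝ :=
  ∑ k, ∑ k', A k k' * (star (w k) * w k').re

theorem hermitianForm_eq_dotProduct_add (A : Matrix ι ι ℝ) (w : ι → ℂ) :
    hermitianForm A w = (fun k => (w k).re) ⬝ᵥ A *ᵥ (fun k => (w k).re) +
      (fun k => (w k).im) ⬝ᵥ A *ᵥ (fun k => (w k).im) := by
  simp only [hermitianForm, dotProduct, mulVec, mul_sum, ← sum_add_distrib]
  refine sum_congr rfl fun k _ => sum_congr rfl fun k' _ => ?_
  rw [Complex.mul_re, Complex.star_def, Complex.conj_re, Complex.conj_im]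
  ring

theorem hermitianForm_one [DecidableEq ι] (w : EuclideanSpace ℂ ι) :
    hermitianForm 1 w = ‖w‖ ^ 2 := by
  simp only [hermitianForm_eq_dotProduct_add, one_mulVec, EuclideanSpace.norm_sq_eq, dotProduct,
    ← sum_add_distrib, Complex.sq_norm, Complex.normSq_apply]

theorem hermitianForm_le [DecidableEq ι] [Nonempty ι] {A : Matrix ι ι ℝ} (hA : A.IsHermitian)
    (w : EuclideanSpace ℂ ι) : hermitianForm A w ≤ largestEigenvalue A * ‖w‖ ^ 2 := by
  rw [← hermitianForm_one, hermitianForm_eq_dotProduct_add, hermitianForm_eq_dotProduct_add,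
    one_mulVec, one_mulVec, mul_add]
  exact add_le_add (dotProduct_mulVec_le_largestEigenvalue_mul hA _)
    (dotProduct_mulVec_le_largestEigenvalue_mul hA _)

theorem expect_normSq_sum_mul {X : Type*} [Fintype X] (w : ι → ℂ) (φ : ι → X → ℝ) (h : X → ℝ) :
    𝔼 x, Complex.normSq (∑ k, w k * (φ k x : ℂ)) * h x =
      hermitianForm (fun k k' => 𝔼 x, h x * (φ k x * φ k' x)) w := by
  simp only [hermitianForm, expect_mul, ← expect_sum_comm]
  refine expect_congr rfl fun x _ => ?_
  have hnormSq (z : ℂ) : Complex.normSq z = (star z * z).re := by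
    rw [Complex.star_def, ← Complex.normSq_eq_conj_mul_self, Complex.ofReal_re]
  rw [hnormSq, star_sum, sum_mul_sum, Complex.re_sum, sum_mul]
  refine sum_congr rfl fun k _ => ?_
  rw [Complex.re_sum, sum_mul]
  refine sum_congr rfl fun k' _ => ?_
  rw [star_mul', Complex.star_def, Complex.conj_ofReal, mul_mul_mul_comm,
    ← Complex.ofReal_mul, Complex.re_mul_ofReal]
  ring

theorem IsPrincipalEigenvector.hermitianForm_eq {l : ℕ} {A : Matrix (Fin l) (Fin l) ℝ}
    {w : EuclideanSpace ℂ (Fin l)} (hw : IsPrincipalEigenvector A w) :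
    hermitianForm A w = largestEigenvalue A := by
  obtain ⟨hnorm, lam, hlam, heig⟩ := hw
  calc hermitianForm A w = ∑ k, (star (w k) * ∑ k', (A k k' : ℂ) * w k').re := by
        simp only [hermitianForm, mul_sum, Complex.re_sum, mul_left_comm (star _),
          Complex.re_ofReal_mul]
    _ = lam * hermitianForm 1 w := by
        simp only [heig, mul_left_comm (star _), Complex.re_ofReal_mul, hermitianForm, one_apply,
          ite_mul, one_mul, zero_mul, sum_ite_eq, mem_univ, if_true, mul_sum]
    _ = largestEigenvalue A := by
        rw [hermitianForm_one, hnorm, one_pow, mul_one]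
        exact hlam.csSup_eq.symm

theorem exists_isPrincipalEigenvector {l : ℕ} [NeZero l] {A : Matrix (Fin l) (Fin l) ℝ}
    (hA : A.IsHermitian) : ∃ w, IsPrincipalEigenvector A w := by
  have hgreatest := isGreatest_largestEigenvalue hA
  obtain ⟨u, hu⟩ := hgreatest.1.exists_hasEigenvector
  set v : EuclideanSpace ℂ (Fin l) := WithLp.toLp 2 fun k => (u k : ℂ)
  have hv : v ≠ 0 := fun h0 => hu.2 <| funext fun k => by
    simpa [v] using congrFun (congrArg WithLp.ofLp h0) k
  refine ⟨((‖v‖⁻¹ : ℝ) : ℂ) • v, ?_, _, hgreatest, fun i => ?_⟩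
  · rw [norm_smul, Complex.norm_real, norm_inv, norm_norm,
      inv_mul_cancel₀ (norm_ne_zero_iff.mpr hv)]
  · have hAu := congrFun hu.apply_eq_smul i
    rw [toLin'_apply, mulVec, dotProduct, Pi.smul_apply, smul_eq_mul] at hAu
    have hAv : ∑ j, (A i j : ℂ) * v j = (largestEigenvalue A : ℂ) * v i := by
      simpa only [Complex.ofReal_sum, Complex.ofReal_mul] using congrArg ((↑) : ℝ → ℂ) hAu
    simp only [PiLp.smul_apply, smul_eq_mul, mul_left_comm _ ((‖v‖⁻¹ : ℝ) : ℂ), ← mul_sum, hAv]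

end HermitianForm

section TridiagonalMatrix

variable (m l : ℕ) (d : ℝ)

/-- The part of `tridiagonal m l d` above the diagonal. -/
noncomputable def superdiagonal : Matrix (Fin (l + 1)) (Fin (l + 1)) ℝ :=
  of fun i j => if (i : ℕ) + 1 = j then √((i + 1) * (m - i)) else 0

theorem superdiagonal_nonneg (i j : Fin (l + 1)) : 0 ≤ superdiagonal m l i j := by
  rw [superdiagonal, of_apply]
  positivity

theorem tridiagonal_eq_diagonal_add_superdiagonal_add_transpose :
    tridiagonal m l d =
      diagonal (fun k : Fin (l + 1) => (k : ℝ) * d) + superdiagonal m l + (superdiagonal m l)ᵀ := by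
  ext i j
  have hcast {a b : Fin (l + 1)} (hab : (a : ℕ) + 1 = b) :
      √((b : ℝ) * (m - b + 1)) = √((a + 1) * (m - a)) := by
    rw [← hab, Nat.cast_succ]
    ring_nf
  rw [Matrix.add_apply, Matrix.add_apply, transpose_apply, superdiagonal, of_apply, of_apply,
    diagonal_apply, tridiagonal]
  by_cases hij : i = j
  · simp [hij]
  by_cases hup : (i : ℕ) + 1 = j
  · simp [hij, hup, show ¬(j : ℕ) + 1 = i by omega, hcast hup]
  by_cases hlow : (j : ℕ) + 1 = i
  · simp [hij, hup, hlow, hcast hlow]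
  · simp [hij, hup, hlow]

theorem isHermitian_tridiagonal : (tridiagonal m l d).IsHermitian := by
  rw [tridiagonal_eq_diagonal_add_superdiagonal_add_transpose, add_assoc,
    ← conjTranspose_eq_transpose_of_trivial]
  exact (isHermitian_diagonal _).add (isHermitian_add_transpose_self _)

theorem dotProduct_superdiagonal_mulVec (x : Fin (l + 1) → ℝ) :
    x ⬝ᵥ superdiagonal m l *ᵥ x =
      ∑ k : Fin l, √((k + 1) * (m - k)) * (x k.castSucc * x k.succ) := by
  have hlast : (superdiagonal m l *ᵥ x) (Fin.last l) = 0 := by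
    rw [mulVec, dotProduct]
    refine sum_eq_zero fun j _ => ?_
    rw [superdiagonal, of_apply, Fin.val_last, if_neg (by omega), zero_mul]
  have hcastSucc (k : Fin l) :
      (superdiagonal m l *ᵥ x) k.castSucc = √((k + 1) * (m - k)) * x k.succ := by
    have hentry (j) : superdiagonal m l k.castSucc j =
        if k.succ = j then √((k + 1) * (m - k)) else 0 := by
      simp only [superdiagonal, of_apply, Fin.ext_iff, Fin.val_castSucc, Fin.val_succ]
    simp only [mulVec, dotProduct, hentry, ite_mul, zero_mul, sum_ite_eq, mem_univ, if_true]
  rw [dotProduct, Fin.sum_univ_castSucc, hlast, mul_zero, add_zero]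
  exact sum_congr rfl fun k _ => by rw [hcastSucc, mul_left_comm]

theorem dotProduct_tridiagonal_mulVec (x : Fin (l + 1) → ℝ) :
    x ⬝ᵥ tridiagonal m l d *ᵥ x = ∑ k : Fin (l + 1), (k : ℝ) * d * x k ^ 2 +
      2 * ∑ k : Fin l, √((k + 1) * (m - k)) * (x k.castSucc * x k.succ) := by
  have htranspose : x ⬝ᵥ (superdiagonal m l)ᵀ *ᵥ x = x ⬝ᵥ superdiagonal m l *ᵥ x := by
    rw [mulVec_transpose, dotProduct_comm, dotProduct_mulVec]
  rw [tridiagonal_eq_diagonal_add_superdiagonal_add_transpose, add_mulVec, add_mulVec,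
    dotProduct_add, dotProduct_add, htranspose, add_assoc, ← two_mul,
    dotProduct_superdiagonal_mulVec]
  congr 1
  exact sum_congr rfl fun k _ => by rw [mulVec_diagonal]; ring

variable {m l}

theorem sum_superdiagonal_row_le (i : Fin (l + 1)) :
    ∑ j, superdiagonal m l i j ≤ √((i + 1) * (m - i)) := by
  simp only [superdiagonal, of_apply, ← sum_filter, sum_const, nsmul_eq_mul]
  refine mul_le_of_le_one_left (Real.sqrt_nonneg _) (Nat.cast_le_one.mpr (card_le_one.mpr ?_))
  simp only [mem_filter, mem_univ, true_and]
  exact fun j hj j' hj' => Fin.ext (hj.symm.trans hj')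

theorem sum_superdiagonal_col_le (j : Fin (l + 1)) :
    ∑ i, superdiagonal m l i j ≤ √(j * (m - j + 1)) := by
  have hentry (i : Fin (l + 1)) :
      superdiagonal m l i j = if (i : ℕ) + 1 = j then √((j : ℝ) * (m - j + 1)) else 0 := by
    rw [superdiagonal, of_apply]
    refine ite_congr rfl (fun hij => ?_) fun _ => rfl
    rw [← hij, Nat.cast_succ]
    ring_nf
  simp only [hentry, ← sum_filter, sum_const, nsmul_eq_mul]
  refine mul_le_of_le_one_left (Real.sqrt_nonneg _) (Nat.cast_le_one.mpr (card_le_one.mpr ?_))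
  simp only [mem_filter, mem_univ, true_and]
  exact fun i hi i' hi' => Fin.ext (by omega)

theorem sum_norm_tridiagonal_offDiagonal_le (k : Fin (l + 1)) :
    ∑ j ∈ univ.erase k, ‖tridiagonal m l d k j‖ ≤
      √((k + 1) * (m - k)) + √(k * (m - k + 1)) := by
  calc ∑ j ∈ univ.erase k, ‖tridiagonal m l d k j‖
      = ∑ j ∈ univ.erase k, (superdiagonal m l k j + superdiagonal m l j k) := by
        refine sum_congr rfl fun j hj => ?_
        rw [tridiagonal_eq_diagonal_add_superdiagonal_add_transpose, Matrix.add_apply,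
          Matrix.add_apply, diagonal_apply_ne _ (ne_of_mem_erase hj).symm, zero_add,
          transpose_apply, Real.norm_of_nonneg]
        exact add_nonneg (superdiagonal_nonneg ..) (superdiagonal_nonneg ..)
    _ ≤ ∑ j, (superdiagonal m l k j + superdiagonal m l j k) :=
        sum_le_univ_sum_of_nonneg fun _ =>
          add_nonneg (superdiagonal_nonneg ..) (superdiagonal_nonneg ..)
    _ ≤ _ := by
        rw [sum_add_distrib]
        exact add_le_add (sum_superdiagonal_row_le k) (sum_superdiagonal_col_le k)

theorem exists_largestEigenvalue_tridiagonal_le :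
    ∃ k ≤ l, largestEigenvalue (tridiagonal m l d) ≤
      k * d + √((k + 1) * (m - k)) + √(k * (m - k + 1)) := by
  obtain ⟨k, hk⟩ :=
    eigenvalue_mem_ball (isGreatest_largestEigenvalue (isHermitian_tridiagonal m l d)).1
  refine ⟨k, k.is_le, ?_⟩
  have hdist := (le_abs_self _).trans
    (hk.trans (sum_norm_tridiagonal_offDiagonal_le d k))
  rw [tridiagonal, if_pos rfl] at hdist
  linarith

theorem sum_ite_lt_add {L : ℕ} (hLl : L ≤ l) :
    ∑ k : Fin (l + 1), (if l < k + L then (1 : ℝ) else 0) = L := by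
  rw [Fin.sum_univ_eq_sum_range (fun k => if l < k + L then (1 : ℝ) else 0), sum_boole,
    show {k ∈ range (l + 1) | l < k + L} = Ico (l + 1 - L) (l + 1) by grind, Nat.card_Ico]
  congr 1
  omega

/-- Rayleigh's principle for the indicator function of the last `L` coordinates. -/
theorem le_largestEigenvalue_tridiagonal {L : ℕ} (hL : 1 ≤ L) (hLl : L ≤ l) (hlm : l ≤ m) :
    L * (l * d - L * |d|) + 2 * ((L - 1) * √((l - L) * (m - l))) ≤
      largestEigenvalue (tridiagonal m l d) * L := by
  let x : Fin (l + 1) → ℝ := fun k => if l < k + L then 1 else 0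
  have hsq (k) : x k ^ 2 = x k := by simp only [x, ite_pow, one_pow, zero_pow two_ne_zero]
  have hsum : ∑ k, x k = L := sum_ite_lt_add hLl
  have hsum_castSucc : ∑ k : Fin l, x k.castSucc = L - 1 := by
    have hlast : x (Fin.last l) = 1 := if_pos (by rw [Fin.val_last]; omega)
    rw [Fin.sum_univ_castSucc, hlast] at hsum
    exact eq_sub_of_add_eq hsum
  have hRayleigh := dotProduct_mulVec_le_largestEigenvalue_mul (isHermitian_tridiagonal m l d) x
  rw [show x ⬝ᵥ x = L by simp only [dotProduct, ← sq, hsq, hsum],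
    dotProduct_tridiagonal_mulVec] at hRayleigh
  refine (add_le_add ?_ (mul_le_mul_of_nonneg_left ?_ zero_le_two)).trans hRayleigh
  · rw [← hsum, sum_mul, hsum]
    refine sum_le_sum fun k _ => ?_
    rw [hsq, mul_comm]
    by_cases hk : l < k + L
    · have hkl : (k : ℝ) ≤ l := by exact_mod_cast k.is_le
      have hkL : (l : ℝ) ≤ k + L := by exact_mod_cast hk.le
      have : ((l : ℝ) - k) * d ≤ L * |d| :=
        (mul_le_mul_of_nonneg_left (le_abs_self d) (sub_nonneg.mpr hkl)).trans
          (mul_le_mul_of_nonneg_right (sub_le_iff_le_add'.mpr hkL) (abs_nonneg d))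
      exact mul_le_mul_of_nonneg_right (by linarith) (by simp only [x, if_pos hk, zero_le_one])
    · simp only [x, if_neg hk, mul_zero, le_refl]
  · rw [← hsum_castSucc, sum_mul]
    refine sum_le_sum fun k _ => ?_
    by_cases hk : l < k + L
    · have hkl : (k : ℝ) ≤ l := by exact_mod_cast k.2.le
      have hkL : (l : ℝ) ≤ k + L := by exact_mod_cast hk.le
      have hlmR : (l : ℝ) ≤ m := by exact_mod_cast hlm
      have : √((l - L : ℝ) * (m - l)) ≤ √((k + 1) * (m - k)) := by
        gcongr; linarith
      have hx : x k.castSucc = 1 := if_pos hk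
      have hx' : x k.succ = 1 := if_pos (by rw [Fin.val_succ]; omega)
      rwa [hx, hx', one_mul, mul_one, mul_one]
    · have hx : x k.castSucc = 0 := if_neg hk
      rw [hx, zero_mul, zero_mul, mul_zero]

end TridiagonalMatrix

section Asymptotics

/-- The limit of the largest eigenvalue of `tridiagonal m l d`, divided by `m`, as `m` and `l` tend
to infinity with `l / m = x`. -/
noncomputable def spectralEdge (d x : ℝ) : ℝ := x * d + 2 * √(x * (1 - x))

theorem mul_sqrt_div_mul_div {m : ℝ} (hm : 0 < m) (x y : ℝ) :
    m * √(x / m * (y / m)) = √(x * y) := by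
  rw [div_mul_div_comm, Real.sqrt_div' _ (by positivity), Real.sqrt_mul_self hm.le,
    mul_div_cancel₀ _ hm.ne']

theorem mul_spectralEdge_div {m : ℝ} (hm : 0 < m) (d x : ℝ) :
    m * spectralEdge d (x / m) = x * d + 2 * √(x * (m - x)) := by
  rw [spectralEdge, one_sub_div hm.ne', mul_add, mul_left_comm m 2, mul_sqrt_div_mul_div hm,
    ← mul_assoc, mul_div_cancel₀ _ hm.ne']

theorem sqrt_add_le_add_sqrt {x y : ℝ} (hx : 0 ≤ x) (hy : 0 ≤ y) : √(x + y) ≤ √x + √y := by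
  simpa only [Real.sqrt_eq_rpow] using
    Real.rpow_add_le_add_rpow hx hy (by norm_num) (by norm_num)

theorem largestEigenvalue_tridiagonal_le {m l : ℕ} {d : ℝ} (hm : 0 < m) (hlm : l ≤ m)
    (hmono : MonotoneOn (spectralEdge d) (Set.Icc 0 (l / m))) :
    largestEigenvalue (tridiagonal m l d) ≤ m * spectralEdge d (l / m) + 2 * √m := by
  obtain ⟨k, hkl, hk⟩ := exists_largestEigenvalue_tridiagonal_le (m := m) (l := l) d
  have hmR : (0 : ℝ) < m := by exact_mod_cast hm
  have hkm : (k : ℝ) ≤ m := by exact_mod_cast hkl.trans hlm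
  have hprod : (0 : ℝ) ≤ k * (m - k) := mul_nonneg k.cast_nonneg (sub_nonneg.mpr hkm)
  have hright : √((k + 1) * (m - k)) ≤ √(k * (m - k)) + √m := by
    rw [add_one_mul]
    exact (sqrt_add_le_add_sqrt hprod (sub_nonneg.mpr hkm)).trans (by gcongr; linarith)
  have hleft : √(k * (m - k + 1)) ≤ √(k * (m - k)) + √m := by
    rw [mul_add_one]
    exact (sqrt_add_le_add_sqrt hprod k.cast_nonneg).trans (by gcongr)
  have hedge : spectralEdge d (k / m) ≤ spectralEdge d (l / m) :=
    hmono ⟨by positivity, by gcongr⟩ ⟨by positivity, le_rfl⟩ (by gcongr)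
  calc largestEigenvalue (tridiagonal m l d)
      ≤ k * d + √((k + 1) * (m - k)) + √(k * (m - k + 1)) := hk
    _ ≤ k * d + 2 * √(k * (m - k)) + 2 * √m := by linarith
    _ = m * spectralEdge d (k / m) + 2 * √m := by rw [mul_spectralEdge_div hmR]
    _ ≤ _ := by gcongr

theorem largestEigenvalue_tridiagonal_div_le {m l : ℕ} {d : ℝ} (hm : 0 < m) (hlm : l ≤ m)
    (hmono : MonotoneOn (spectralEdge d) (Set.Icc 0 (l / m))) :
    largestEigenvalue (tridiagonal m l d) / m ≤ spectralEdge d (l / m) + 2 * (√m)⁻¹ := by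
  have hmR : (0 : ℝ) < m := by exact_mod_cast hm
  rw [div_le_iff₀ hmR, add_mul, mul_assoc 2, inv_mul_eq_div, Real.div_sqrt, mul_comm _ (m : ℝ)]
  exact largestEigenvalue_tridiagonal_le hm hlm hmono

theorem le_largestEigenvalue_tridiagonal_div {m l L : ℕ} (d : ℝ) (hL : 1 ≤ L) (hLl : L ≤ l)
    (hlm : l ≤ m) :
    l / m * d - L / m * |d| + 2 * ((1 - (L : ℝ)⁻¹) * √((l / m - L / m) * (1 - l / m))) ≤
      largestEigenvalue (tridiagonal m l d) / m := by
  have hLR : (0 : ℝ) < L := by exact_mod_cast hL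
  have hmR : (0 : ℝ) < m := by exact_mod_cast hL.trans (hLl.trans hlm)
  have hsqrt := mul_sqrt_div_mul_div hmR (l - L) (m - l)
  rw [sub_div, sub_div, div_self hmR.ne'] at hsqrt
  rw [le_div_iff₀ hmR, ← mul_le_mul_iff_left₀ hLR]
  refine le_of_eq_of_le ?_ (le_largestEigenvalue_tridiagonal d hL hLl hlm)
  rw [← hsqrt]
  field_simp

theorem tendsto_nat_sqrt_atTop : Tendsto Nat.sqrt atTop atTop :=
  tendsto_atTop.mpr fun b => (eventually_ge_atTop (b * b)).mono fun _ => Nat.le_sqrt.mpr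

theorem tendsto_nat_sqrt_div {m l : ℕ → ℕ} (hl : Tendsto l atTop atTop) (hlm : ∀ N, l N ≤ m N) :
    Tendsto (fun N => (Nat.sqrt (l N) : ℝ) / m N) atTop (𝓝 0) := by
  have hL : Tendsto (fun N => Nat.sqrt (l N)) atTop atTop := tendsto_nat_sqrt_atTop.comp hl
  refine squeeze_zero' (Eventually.of_forall fun N => by positivity) ?_
    (tendsto_inv_atTop_zero.comp (tendsto_natCast_atTop_atTop.comp hL))
  filter_upwards [hL.eventually_gt_atTop 0, hl.eventually_gt_atTop 0] with N hLN hlN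
  have hsq : (Nat.sqrt (l N) : ℝ) * Nat.sqrt (l N) ≤ m N := by
    exact_mod_cast (Nat.sqrt_le (l N)).trans (hlm N)
  rwa [Function.comp_apply, Function.comp_apply, inv_eq_one_div,
    div_le_div_iff₀ (by exact_mod_cast hlN.trans_le (hlm N)) (by exact_mod_cast hLN), one_mul]

theorem tendsto_largestEigenvalue_tridiagonal_div {m l : ℕ → ℕ} {d μ : ℝ}
    (hm : Tendsto m atTop atTop) (hl : Tendsto l atTop atTop) (hlm : ∀ N, l N ≤ m N)
    (hμ : ∀ N, (l N : ℝ) / m N = μ) (hmono : MonotoneOn (spectralEdge d) (Set.Icc 0 μ)) :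
    Tendsto (fun N => largestEigenvalue (tridiagonal (m N) (l N) d) / m N) atTop
      (𝓝 (spectralEdge d μ)) := by
  let L : ℕ → ℕ := fun N => Nat.sqrt (l N)
  have hL : Tendsto L atTop atTop := tendsto_nat_sqrt_atTop.comp hl
  have hLinv : Tendsto (fun N => (L N : ℝ)⁻¹) atTop (𝓝 0) :=
    tendsto_inv_atTop_zero.comp (tendsto_natCast_atTop_atTop.comp hL)
  have hL_div : Tendsto (fun N => (L N : ℝ) / m N) atTop (𝓝 0) := tendsto_nat_sqrt_div hl hlm
  have hsqrt_inv : Tendsto (fun N => (√(m N : ℝ))⁻¹) atTop (𝓝 0) :=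
    tendsto_inv_atTop_zero.comp
      (Real.tendsto_sqrt_atTop.comp (tendsto_natCast_atTop_atTop.comp hm))
  have hlower : Tendsto (fun N => μ * d - L N / m N * |d| +
      2 * ((1 - (L N : ℝ)⁻¹) * √((μ - L N / m N) * (1 - μ)))) atTop (𝓝 (spectralEdge d μ)) := by
    have hsqrt := ((hL_div.const_sub μ).mul_const (1 - μ)).sqrt
    have := ((hL_div.mul_const |d|).const_sub (μ * d)).add
      (((hLinv.const_sub 1).mul hsqrt).const_mul 2)
    simpa only [zero_mul, sub_zero, one_mul, spectralEdge] using this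
  have hupper : Tendsto (fun N => spectralEdge d μ + 2 * (√(m N : ℝ))⁻¹) atTop
      (𝓝 (spectralEdge d μ)) := by
    simpa only [mul_zero, add_zero] using (hsqrt_inv.const_mul 2).const_add (spectralEdge d μ)
  refine tendsto_of_tendsto_of_tendsto_of_le_of_le' hlower hupper ?_ ?_
  · filter_upwards [hL.eventually_ge_atTop 1] with N hLN
    simpa only [hμ] using le_largestEigenvalue_tridiagonal_div d hLN (Nat.sqrt_le_self _) (hlm N)
  · filter_upwards [hm.eventually_gt_atTop 0] with N hmN
    simpa only [hμ] using largestEigenvalue_tridiagonal_div_le hmN (hlm N) ((hμ N).symm ▸ hmono)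

end Asymptotics

section Bracket

variable {q x : ℝ}

theorem sqrt_mul_spectralEdge_skewness (hq0 : 0 < q) (hq1 : q < 1) (x : ℝ) :
    √(q * (1 - q)) * spectralEdge (skewness q) x = bracket q x := by
  have hσ : √(q * (1 - q)) ≠ 0 := (Real.sqrt_pos.mpr (mul_pos hq0 (sub_pos.mpr hq1))).ne'
  rw [spectralEdge, skewness, bracket]
  field_simp

theorem bracket_eq_sub_sq (hq0 : 0 ≤ q) (hq1 : q ≤ 1) (hx0 : 0 ≤ x) (hx1 : x ≤ 1) :
    bracket q x = 1 - q - (√((1 - x) * (1 - q)) - √(x * q)) ^ 2 := by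
  have hx1' := sub_nonneg.mpr hx1
  have hq1' := sub_nonneg.mpr hq1
  rw [sub_sq, Real.sq_sqrt (mul_nonneg hx1' hq1'), Real.sq_sqrt (mul_nonneg hx0 hq0), bracket,
    Real.sqrt_mul hx1', Real.sqrt_mul hx0, Real.sqrt_mul hq0, Real.sqrt_mul hx0]
  ring

theorem monotoneOn_bracket (hq0 : 0 ≤ q) (hq1 : q ≤ 1) :
    MonotoneOn (bracket q) (Set.Icc 0 (1 - q)) := by
  rintro x ⟨hx0, hx1⟩ y ⟨hy0, hy1⟩ hxy
  have hgap : 0 ≤ √((1 - y) * (1 - q)) - √(y * q) :=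
    sub_nonneg.mpr (Real.sqrt_le_sqrt (by linarith))
  have hxy_gap : √((1 - y) * (1 - q)) - √(y * q) ≤ √((1 - x) * (1 - q)) - √(x * q) := by
    gcongr
  rw [bracket_eq_sub_sq hq0 hq1 hx0 (by linarith), bracket_eq_sub_sq hq0 hq1 hy0 (by linarith)]
  gcongr

theorem bracket_nonneg (hq0 : 0 ≤ q) (hq1 : q ≤ 1) (hx0 : 0 ≤ x) (hx1 : x ≤ 1 - q) :
    0 ≤ bracket q x := by
  have hzero : bracket q 0 = 0 := by simp [bracket]
  exact hzero.symm.trans_le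
    (monotoneOn_bracket hq0 hq1 ⟨le_rfl, sub_nonneg.mpr hq1⟩ ⟨hx0, hx1⟩ hx0)

theorem monotoneOn_spectralEdge_skewness (hq0 : 0 < q) (hq1 : q < 1) :
    MonotoneOn (spectralEdge (skewness q)) (Set.Icc 0 (1 - q)) := by
  intro x hx y hy hxy
  have := monotoneOn_bracket hq0.le hq1.le hx hy hxy
  rw [← sqrt_mul_spectralEdge_skewness hq0 hq1, ← sqrt_mul_spectralEdge_skewness hq0 hq1] at this
  exact le_of_mul_le_mul_left this (Real.sqrt_pos.mpr (mul_pos hq0 (sub_pos.mpr hq1)))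

end Bracket

section RowWeights

variable {p m n : ℕ} {B : Matrix (Fin m) (Fin n) (ZMod p)} {ε : ℝ}

theorem tau1_nonneg (hε : ε ≤ 1) : 0 ≤ tau1 B ε :=
  div_nonneg (sum_nonneg fun _ _ => pow_nonneg (sub_nonneg.mpr hε) _) m.cast_nonneg

theorem tau1_le_of_le_hammingNorm (hm : 0 < m) (hε0 : 0 ≤ ε) (hε1 : ε ≤ 1) {L : ℕ}
    (hL : ∀ i, L ≤ hammingNorm (B i)) : tau1 B ε ≤ (1 - ε) ^ L := by
  rw [tau1, div_le_iff₀' (Nat.cast_pos.mpr hm)]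
  simpa using sum_le_card_nsmul univ _ _ fun i _ =>
    pow_le_pow_of_le_one (sub_nonneg.mpr hε1) (sub_le_self 1 hε0) (hL i)

theorem le_tau1_of_hammingNorm_le (hm : 0 < m) (hε0 : 0 ≤ ε) (hε1 : ε ≤ 1) {L : ℕ}
    (hL : ∀ i, hammingNorm (B i) ≤ L) : (1 - ε) ^ L ≤ tau1 B ε := by
  rw [tau1, le_div_iff₀' (Nat.cast_pos.mpr hm)]
  simpa using card_nsmul_le_sum univ _ _ fun i _ =>
    pow_le_pow_of_le_one (sub_nonneg.mpr hε1) (sub_le_self 1 hε0) (hL i)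

end RowWeights

section Optimum

namespace MaxLinSAT

variable {p m n l : ℕ} {I : MaxLinSAT p m n} {q ε : ℝ}

theorem satisfied_eq_add_sum_stdIndicator (hq0 : 0 < q) (hq1 : q < 1) (x : Fin n → ZMod p) :
    (I.satisfied x : ℝ) =
      m * q + √(q * (1 - q)) * ∑ i, stdIndicator q (I.F i) ((I.B *ᵥ x) i) := by
  rw [satisfied, ← sum_boole]
  simp only [ite_mem_eq_add_stdIndicator hq0 hq1, sum_add_distrib, mul_sum, sum_const, card_univ,
    Fintype.card_fin, nsmul_eq_mul]

variable [Fact p.Prime] (hF : ∀ i, ((I.F i).card : ℝ) / p = q)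
include hF

theorem expect_stdIndicator_F (i : Fin m) : 𝔼 y, stdIndicator q (I.F i) y = 0 :=
  expect_stdIndicator (by simpa only [ZMod.card] using hF i)

variable (hq0 : 0 < q) (hq1 : q < 1)
include hq0 hq1

theorem expect_stdIndicator_F_sq (i : Fin m) : 𝔼 y, stdIndicator q (I.F i) y ^ 2 = 1 :=
  expect_stdIndicator_sq (by simpa only [ZMod.card] using hF i) hq0 hq1

theorem sum_prod_depolarizingKernel_mul_satisfied (ε : ℝ) (a : Fin n → ZMod p) :
    ∑ x, (∏ j, depolarizingKernel ε (a j) (x j)) * I.satisfied x =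
      m * q + √(q * (1 - q)) *
        ∑ i, (1 - ε) ^ hammingNorm (I.B i) * stdIndicator q (I.F i) ((I.B *ᵥ a) i) := by
  have hrow (i : Fin m) : ∑ x, (∏ j, depolarizingKernel ε (a j) (x j)) *
      stdIndicator q (I.F i) ((I.B *ᵥ x) i) =
        (1 - ε) ^ hammingNorm (I.B i) * stdIndicator q (I.F i) ((I.B *ᵥ a) i) :=
    sum_prod_depolarizingKernel_mul_dotProduct ε (expect_stdIndicator_F hF i) a (I.B i)
  simp only [satisfied_eq_add_sum_stdIndicator hq0 hq1, mul_add, sum_add_distrib, ← hrow]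
  rw [← sum_mul, sum_prod_depolarizingKernel, one_mul, sum_comm, mul_sum]
  simp only [mul_sum, mul_left_comm √_]

theorem sum_normSq_dqiState_mul (w : EuclideanSpace ℂ (Fin (l + 1)))
    (h : (Fin n → ZMod p) → ℝ) :
    ∑ x, Complex.normSq (I.dqiState w x) * h x =
      hermitianForm (fun k k' : Fin (l + 1) => 𝔼 x, h x *
        (normalizedEsymm I.B (fun i => stdIndicator q (I.F i)) k x *
          normalizedEsymm I.B (fun i => stdIndicator q (I.F i)) k' x)) w := by
  rw [← expect_normSq_sum_mul w
    (fun k x => normalizedEsymm I.B (fun i => stdIndicator q (I.F i)) k x),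
    Fintype.expect_eq_sum_div_card, sum_div]
  refine sum_congr rfl fun x _ => ?_
  simp only [dqiState, basisState_eq_normalizedEsymm hF hq0 hq1, Complex.ofReal_div,
    ← mul_div_assoc, ← sum_div, Complex.normSq_div, Complex.normSq_ofReal]
  rw [Real.mul_self_sqrt (by positivity), div_mul_eq_mul_div]
  simp only [Fintype.card_fun, ZMod.card, Fintype.card_fin, Nat.cast_pow]

variable (hlm : l ≤ m)
include hlm

theorem sum_normSq_dqiState
    (hB : ∀ T : Finset (Fin m), T.card ≤ 2 * l → LinearIndepOn (ZMod p) I.B.row T)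
    (w : EuclideanSpace ℂ (Fin (l + 1))) :
    ∑ x, Complex.normSq (I.dqiState w x) = ‖w‖ ^ 2 := by
  have hsum := sum_normSq_dqiState_mul hF hq0 hq1 w fun _ => 1
  simp only [mul_one, one_mul] at hsum
  rw [hsum, ← hermitianForm_one]
  congr with k k'
  rw [expect_normalizedEsymm_mul_normalizedEsymm (expect_stdIndicator_F hF)
    (expect_stdIndicator_F_sq hF hq0 hq1) (fun T hT => hB T (by omega))
    (by rw [Fintype.card_fin]; omega), one_apply]
  simp only [Fin.val_inj]

variable (hB : ∀ T : Finset (Fin m), T.card ≤ 2 * l + 1 → LinearIndepOn (ZMod p) I.B.row T)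
include hB

theorem sum_normSq_dqiState_mul_stdIndicator (w : EuclideanSpace ℂ (Fin (l + 1))) (i : Fin m) :
    ∑ x, Complex.normSq (I.dqiState w x) * stdIndicator q (I.F i) ((I.B *ᵥ x) i) =
      hermitianForm (tridiagonal m l (skewness q)) w / m := by
  have h3 (i : Fin m) : 𝔼 y, stdIndicator q (I.F i) y ^ 3 = skewness q :=
    expect_stdIndicator_cube (by simpa only [ZMod.card] using hF i) hq0 hq1
  rw [sum_normSq_dqiState_mul hF hq0 hq1]
  simp only [expect_mul_normalizedEsymm_mul_normalizedEsymm (expect_stdIndicator_F hF)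
    (expect_stdIndicator_F_sq hF hq0 hq1) h3 i hB (hlm.trans_eq (Fintype.card_fin m).symm),
    Fintype.card_fin, hermitianForm, sum_div, div_mul_eq_mul_div]

theorem expectedSatisfied_dqiState {w : EuclideanSpace ℂ (Fin (l + 1))} (hw : ‖w‖ = 1) :
    I.expectedSatisfied ε (I.dqiState w) =
      m * q + √(q * (1 - q)) * tau1 I.B ε * hermitianForm (tridiagonal m l (skewness q)) w := by
  have hnorm : ∑ x, Complex.normSq (I.dqiState w x) = 1 := by
    rw [sum_normSq_dqiState hF hq0 hq1 hlm fun T hT => hB T (by omega), hw, one_pow]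
  rw [expectedSatisfied_eq_sum]
  simp only [sum_prod_depolarizingKernel_mul_satisfied hF hq0 hq1, mul_add, sum_add_distrib]
  rw [← sum_mul, hnorm, one_mul]
  congr 1
  simp only [mul_sum, mul_left_comm (Complex.normSq _)]
  rw [sum_comm]
  simp only [← mul_sum, sum_normSq_dqiState_mul_stdIndicator hF hq0 hq1 hlm hB, ← sum_mul, tau1]
  ring

theorem isGreatest_achievable (hε : ε ≤ 1) {w : EuclideanSpace ℂ (Fin (l + 1))}
    (hw : IsPrincipalEigenvector (tridiagonal m l (skewness q)) w) :
    IsGreatest (I.achievable l ε) (I.expectedSatisfied ε (I.dqiState w)) := by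
  obtain ⟨P, hP, hPw⟩ := exists_polyState_eq_dqiState hF hq0 hq1 w
  refine ⟨⟨P, w, hP, hw.1, hPw, by rw [hPw]⟩, ?_⟩
  rintro _ ⟨P', w', -, hw', hPw', rfl⟩
  rw [hPw', expectedSatisfied_dqiState hF hq0 hq1 hlm hB hw',
    expectedSatisfied_dqiState hF hq0 hq1 hlm hB hw.1, hw.hermitianForm_eq]
  have := tau1_nonneg (B := I.B) hε
  gcongr
  simpa only [hw', one_pow, mul_one] using hermitianForm_le (isHermitian_tridiagonal m l _) w'

theorem optSatisfied_eq (hε : ε ≤ 1) :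
    I.optSatisfied l ε = m * q + √(q * (1 - q)) * tau1 I.B ε *
      largestEigenvalue (tridiagonal m l (skewness q)) := by
  obtain ⟨w, hw⟩ := exists_isPrincipalEigenvector (isHermitian_tridiagonal m l (skewness q))
  rw [optSatisfied, (isGreatest_achievable hF hq0 hq1 hlm hB hε hw).csSup_eq,
    expectedSatisfied_dqiState hF hq0 hq1 hlm hB hw.1, hw.hermitianForm_eq]

end MaxLinSAT

end Optimum

section Limits

variable {p : ℕ} [Fact p.Prime] {q ε μ : ℝ} {m n l : ℕ → ℕ} {I : ∀ N, MaxLinSAT p (m N) (n N)}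

theorem tendsto_optSatisfied_div_sub (hF : ∀ N i, (((I N).F i).card : ℝ) / p = q) (hq0 : 0 < q)
    (hq1 : q < 1) (hlm : ∀ N, l N ≤ m N)
    (hB : ∀ N, ∀ T : Finset (Fin (m N)), T.card ≤ 2 * l N + 1 →
      LinearIndepOn (ZMod p) (I N).B.row T)
    (hm : Tendsto m atTop atTop) (hl : Tendsto l atTop atTop)
    (hlm_div : ∀ N, (l N : ℝ) / m N = μ) (hμ : μ ≤ 1 - q) (hε0 : 0 ≤ ε) (hε1 : ε ≤ 1) :
    Tendsto (fun N => (I N).optSatisfied (l N) ε / m N - (q + tau1 (I N).B ε * bracket q μ))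
      atTop (𝓝 0) := by
  let Λ : ℕ → ℝ := fun N =>
    √(q * (1 - q)) * (largestEigenvalue (tridiagonal (m N) (l N) (skewness q)) / m N)
  have hΛ : Tendsto Λ atTop (𝓝 (bracket q μ)) := by
    rw [← sqrt_mul_spectralEdge_skewness hq0 hq1]
    exact (tendsto_largestEigenvalue_tridiagonal_div hm hl hlm hlm_div
      ((monotoneOn_spectralEdge_skewness hq0 hq1).mono (Set.Icc_subset_Icc_right hμ))).const_mul _
  have hgap : Tendsto (fun N => |Λ N - bracket q μ|) atTop (𝓝 0) := by
    simpa using (hΛ.sub_const (bracket q μ)).abs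
  refine squeeze_zero_norm' ?_ hgap
  filter_upwards [hm.eventually_gt_atTop 0] with N hmN
  have hopt : (I N).optSatisfied (l N) ε / m N = q + tau1 (I N).B ε * Λ N := by
    rw [MaxLinSAT.optSatisfied_eq (hF N) hq0 hq1 (hlm N) (hB N) hε1]
    simp only [Λ]
    field_simp
  rw [hopt, add_sub_add_left_eq_sub, ← mul_sub, norm_mul, Real.norm_eq_abs, Real.norm_eq_abs,
    abs_of_nonneg (tau1_nonneg hε1)]
  exact mul_le_of_le_one_left (abs_nonneg _)
    ((tau1_le_of_le_hammingNorm hmN hε0 hε1 fun _ => Nat.zero_le _).trans_eq (pow_zero _))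

theorem le_liminf_and_limsup_le_of_tendsto_sub {ι : Type*} {F : Filter ι} [F.NeBot] {u v : ι → ℝ}
    {a b : ℝ} (huv : Tendsto (fun j => u j - v j) F (𝓝 0)) (ha : ∀ j, a ≤ v j) (hb : ∀ j, v j ≤ b) :
    a ≤ liminf u F ∧ limsup u F ≤ b := by
  have hlower : Tendsto (fun j => a + (u j - v j)) F (𝓝 a) := by
    simpa using huv.const_add a
  have hupper : Tendsto (fun j => b + (u j - v j)) F (𝓝 b) := by
    simpa using huv.const_add b
  have hle_u : ∀ᶠ j in F, a + (u j - v j) ≤ u j := .of_forall fun j => by linarith [ha j]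
  have hu_le : ∀ᶠ j in F, u j ≤ b + (u j - v j) := .of_forall fun j => by linarith [hb j]
  constructor
  · rw [← hlower.liminf_eq]
    exact liminf_le_liminf hle_u hlower.isBoundedUnder_ge
      (hupper.isBoundedUnder_le.mono_le hu_le).isCoboundedUnder_ge
  · rw [← hupper.limsup_eq]
    exact limsup_le_limsup hu_le (hlower.isBoundedUnder_ge.mono_ge hle_u).isCoboundedUnder_le
      hupper.isBoundedUnder_le

end Limits

end NoisyDQI

open NoisyDQI in
theorem mainTheorem2 (p : ℕ) [Fact p.Prime] (r : ℕ) (hr : 1 ≤ r) (hrp : r ≤ p - 1)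
    (ε : ℝ) (hε₀ : 0 ≤ ε) (hε₁ : ε ≤ 1)
    (μ : ℝ) (hμ : μ ≤ 1 - (r : ℝ) / (p : ℝ))
    (m n l : ℕ → ℕ) (I : ∀ N, MaxLinSAT p (m N) (n N))
    (hn : ∀ N, 0 < n N) (hmn : ∀ N, n N < m N)
    (hF : ∀ N i, ((I N).F i).card = r)
    (hd : ∀ N, ((2 * l N + 1 : ℕ) : ℕ∞) < minDistance (dualCode (I N).B))
    (hm : Tendsto m atTop atTop) (hl : Tendsto l atTop atTop)
    (hlm : ∀ N, (l N : ℝ) / (m N : ℝ) = μ) :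
    -- the principal eigenvectors of `A` exist, come from polynomials, and are optimal
    (∀ N,
      (∃ w, IsPrincipalEigenvector
        (tridiagonal (m N) (l N) (((p : ℝ) - 2 * r) / Real.sqrt (r * ((p : ℝ) - r)))) w) ∧
      ∀ w, IsPrincipalEigenvector
        (tridiagonal (m N) (l N) (((p : ℝ) - 2 * r) / Real.sqrt (r * ((p : ℝ) - r)))) w →
        (∃ P : ℂ[X], P.natDegree ≤ l N ∧ (I N).polyState P = (I N).dqiState w) ∧
        IsGreatest ((I N).achievable (l N) ε)
          ((I N).expectedSatisfied ε ((I N).dqiState w))) ∧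
    -- the asymptotic value of the optimum, for matrices `B` that vary with `m`
    Tendsto (fun N => (I N).optSatisfied (l N) ε / (m N : ℝ)
        - ((r : ℝ) / p + tau1 (I N).B ε * bracket ((r : ℝ) / p) μ)) atTop (𝓝 0) ∧
    -- in particular the limit of the optimum, when `τ₁(B, ε)` is constant or has a limit
    (∀ τ : ℝ, Tendsto (fun N => tau1 (I N).B ε) atTop (𝓝 τ) →
      Tendsto (fun N => (I N).optSatisfied (l N) ε / (m N : ℝ)) atTop
        (𝓝 ((r : ℝ) / p + τ * bracket ((r : ℝ) / p) μ))) ∧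
    -- the bounds under row-weight bounds, on the lower and upper limits and on the limit
    (∀ L₁ L₂ : ℕ,
      (∀ N i, L₁ ≤ hammingNorm ((I N).B i) ∧ hammingNorm ((I N).B i) ≤ L₂) →
      ((1 - ε) ^ L₂ * bracket ((r : ℝ) / p) μ ≤
          liminf (fun N => (I N).optSatisfied (l N) ε / (m N : ℝ) - (r : ℝ) / p) atTop ∧
        limsup (fun N => (I N).optSatisfied (l N) ε / (m N : ℝ) - (r : ℝ) / p) atTop ≤
          (1 - ε) ^ L₁ * bracket ((r : ℝ) / p) μ) ∧
      ∀ s : ℝ, Tendsto (fun N => (I N).optSatisfied (l N) ε / (m N : ℝ)) atTop (𝓝 s) →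
        (1 - ε) ^ L₂ * bracket ((r : ℝ) / p) μ ≤ s - (r : ℝ) / p ∧
        s - (r : ℝ) / p ≤ (1 - ε) ^ L₁ * bracket ((r : ℝ) / p) μ) := by
  have hp : (0 : ℝ) < p := Nat.cast_pos.mpr (Fact.out : p.Prime).pos
  have hq0 : 0 < (r : ℝ) / p := div_pos (Nat.cast_pos.mpr hr) hp
  have hq1 : (r : ℝ) / p < 1 := (div_lt_one hp).mpr (by exact_mod_cast (by omega : r < p))
  have hdensity (N i) : (((I N).F i).card : ℝ) / p = r / p := by rw [hF]
  have hlm' (N) : l N ≤ m N := by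
    have := Nat.cast_lt.mp ((hd N).trans_le (minDistance_dualCode_le _ (hmn N)))
    omega
  have hrows (N) (T : Finset (Fin (m N))) (hT : T.card ≤ 2 * l N + 1) :
      LinearIndepOn (ZMod p) (I N).B.row T :=
    linearIndepOn_row_of_card_lt_minDistance _ ((Nat.cast_le.mpr hT).trans_lt (hd N))
  have hβ : 0 ≤ bracket ((r : ℝ) / p) μ :=
    bracket_nonneg hq0.le hq1.le (hlm 0 ▸ by positivity) hμ
  have hlim := tendsto_optSatisfied_div_sub hdensity hq0 hq1 hlm' hrows hm hl hlm hμ hε₀ hε₁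
  rw [← skewness_div hp]
  refine ⟨fun N => ⟨exists_isPrincipalEigenvector (isHermitian_tridiagonal ..), fun w hw =>
    ⟨MaxLinSAT.exists_polyState_eq_dqiState (hdensity N) hq0 hq1 w,
      MaxLinSAT.isGreatest_achievable (hdensity N) hq0 hq1 (hlm' N) (hrows N) hε₁ hw⟩⟩,
    hlim, fun τ hτ => ?_, fun L₁ L₂ hL => ?_⟩
  · simpa using hlim.add ((hτ.mul_const (bracket ((r : ℝ) / p) μ)).const_add ((r : ℝ) / p))
  · have hbounds := le_liminf_and_limsup_le_of_tendsto_sub (by simpa only [← sub_sub] using hlim)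
      (fun N => mul_le_mul_of_nonneg_right (le_tau1_of_hammingNorm_le ((hn N).trans (hmn N))
        hε₀ hε₁ fun i => (hL N i).2) hβ)
      (fun N => mul_le_mul_of_nonneg_right (tau1_le_of_le_hammingNorm ((hn N).trans (hmn N))
        hε₀ hε₁ fun i => (hL N i).1) hβ)
    refine ⟨hbounds, fun s hs => ?_⟩
    have hs' := hs.sub_const ((r : ℝ) / p)
    rwa [hs'.liminf_eq, hs'.limsup_eq] at hbounds
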